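/- Let $d\ge 1$, $\rho>0$, and let $E\subset\mathbb{R}^d$ be a set of class $C^2$ (near each point of $\partial E$ there is a $C^2$ function with nonvanishing gradient whose negativity set is contained in $E$ and whose positivity set is contained in $E^c=\mathbb{R}^d\setminus E$) with compact boundary $\partial E$. Let $\nu_E$ be its outer unit normal and $\nabla\nu_E$ its tangential gradient, extended by $0$ in the normal direction. For $F\subset\mathbb{R}^d$ put $$\mathcal{E}_\rho(F)=\frac1{2\rho}\int_{\mathbb{R}^d}\operatorname{osc}_{B(x,\rho)}(\chi_F)\,dx,\qquad \operatorname{osc}_A(u)=\operatorname{ess\,sup}_A u-\operatorname{ess\,inf}_A u .$$ For $x\in\partial E$ put $\kappa_\rho(x)=\kappa_\rho^+(x)+\kappa_\rho^-(x)$, where $$\kappa_\rho^+(x)=\begin{cases}\frac1{2\rho}\det(I+\rho\nabla\nu_E(x))&\text{if }\operatorname{dist}(x+\rho\nu_E(x),E)=\rho,\\0&\text{otherwise,}\end{cases}\qquad \kappa_\rho^-(x)=\begin{cases}-\frac1{2\rho}\det(I-\rho\nabla\nu_E(x))&\text{if }\operatorname{dist}(x-\rho\nu_E(x),E^c)=\rho,\\0&\text{otherwise.}\end{cases}$$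 Let $A_\rho^+$ be the set of $x\in\partial E$ such that $\operatorname{dist}(x+t\nu_E(x),E)=t$ for some $t>\rho$, let $B_\rho^+$ be the set of $x\in\partial E$ with $\operatorname{dist}(x+\rho\nu_E(x),E)<\rho$, and let $\mathcal N_\rho^+=\partial E\setminus(A_\rho^+\cup B_\rho^+)$. Define $A_\rho^-,B_\rho^-,\mathcal N_\rho^-$ in the same way with $\nu_E$ replaced by $-\nu_E$ and $E$ replaced by $E^c$, and let $\mathcal N_\rho=\mathcal N_\rho^+\cup\mathcal N_\rho^-$. Assume that $\mathcal H^{d-1}(\mathcal N_\rho)=0$. Let $\varphi\in C^2(\partial E;\mathbb{R})$ and let $(\Phi_\varepsilon)_{\varepsilon\in\mathbb{R}}$ be $C^1$ diffeomorphisms of $\mathbb{R}^d$ such that, for all $\varepsilon$ close to $0$, $\Phi_\varepsilon(x)=x+\varepsilon\varphi(x)\nu_E(x)$ for every $x\in\partial E$. Then $\mathcal{E}_\rho(\Phi_\varepsilon(E))$ is finite for all $\varepsilon$ close to $0$, $\kappa_\rho\varphi$ is $\mathcal H^{d-1}$-integrable on $\partial E$, the function $\varepsilon\mapsto\mathcal{E}_\rho(\Phi_\varepsilon(E))$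 is differentiable at $0$, and $$\frac{d}{d\varepsilon}\mathcal{E}_\rho\big(\Phi_\varepsilon(E)\big)\Big|_{\varepsilon=0}=\int_{\partial E}\kappa_\rho\,\varphi\,d\mathcal H^{d-1}.$$ -/

import Mathlib

open MeasureTheory Set Filter Topology
open scoped Manifold ENNReal

noncomputable section

namespace NonlocalCurvature

variable {d : ℕ}

/-! ### The energy -/

/-- The essential oscillation of `u` over `A` (used for bounded functions `u`). -/
def essOsc (A : Set (EuclideanSpace ℝ (Fin d))) (u : EuclideanSpace ℝ (Fin d) → ℝ) : ℝ :=
  essSup u (volume.restrict A) - essInf u (volume.restrict A)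

/-- The energy `(1 / 2ρ) ∫ osc_{B(x, ρ)} (χ_F) dx`, with values in `[0, ∞]`. -/
def energy (ρ : ℝ) (F : Set (EuclideanSpace ℝ (Fin d))) : ℝ≥0∞ :=
  ENNReal.ofReal (1 / (2 * ρ)) *
    ∫⁻ x, ENNReal.ofReal (essOsc (Metric.ball x ρ) (F.indicator fun _ => (1 : ℝ)))

/-! ### Sets of class `C²` and their outer normal -/

/-- `ψ` is a `C²` function with nonvanishing gradient on the open neighbourhood `U` of `x`, negative
only at points of `E` and positive only at points of the complement of `E`. -/
structure IsLocalDefiningFunction (E : Set (EuclideanSpace ℝ (Fin d)))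
    (x : EuclideanSpace ℝ (Fin d)) (U : Set (EuclideanSpace ℝ (Fin d)))
    (ψ : EuclideanSpace ℝ (Fin d) → ℝ) : Prop where
  isOpen : IsOpen U
  mem : x ∈ U
  contDiffOn : ContDiffOn ℝ 2 ψ U
  gradient_ne_zero : ∀ y ∈ U, gradient ψ y ≠ 0
  neg : ∀ y ∈ U, ψ y < 0 → y ∈ E
  pos : ∀ y ∈ U, 0 < ψ y → y ∉ E

/-- `E` is a set of class `C²`: near each of its boundary points it lies on one side of a
`C²` hypersurface. Which points of the boundary belong to `E` is left free. -/
def IsClassC2 (E : Set (EuclideanSpace ℝ (Fin d))) : Prop :=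
  ∀ x ∈ frontier E, ∃ U ψ, IsLocalDefiningFunction E x U ψ

open Classical in
/-- The outer unit normal of a set of class `C²` at a boundary point `x`: the normalised gradient at
`x` of a local defining function (any one, by `outerNormal_eq`). -/
def outerNormal (E : Set (EuclideanSpace ℝ (Fin d))) (x : EuclideanSpace ℝ (Fin d)) :
    EuclideanSpace ℝ (Fin d) :=
  if h : ∃ v U ψ, IsLocalDefiningFunction E x U ψ ∧ v = ‖gradient ψ x‖⁻¹ • gradient ψ x
  then h.choose else 0

/-- A function that vanishes at `x` takes positive values in any direction that makes an acute
angle with its gradient. -/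
lemma eventually_pos_of_inner_gradient_pos {ψ : EuclideanSpace ℝ (Fin d) → ℝ}
    {x h : EuclideanSpace ℝ (Fin d)} (hd : DifferentiableAt ℝ ψ x) (h0 : ψ x = 0)
    (hpos : 0 < inner ℝ (gradient ψ x) h) : ∀ᶠ t : ℝ in 𝓝[>] 0, 0 < ψ (x + t • h) := by
  have h1 : HasDerivAt (fun t : ℝ => x + t • h) h 0 := by
    simpa using ((hasDerivAt_id (0 : ℝ)).smul_const h).const_add x
  have h2 : HasFDerivAt ψ (fderiv ℝ ψ x) (x + (0 : ℝ) • h) := by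
    simpa using hd.hasFDerivAt
  have h3 : HasDerivAt (fun t : ℝ => ψ (x + t • h)) (inner ℝ (gradient ψ x) h) 0 := by
    have := h2.comp_hasDerivAt (0 : ℝ) h1
    rwa [← inner_gradient_left] at this
  have h4 := (hasDerivAt_iff_tendsto_slope.1 h3).eventually (lt_mem_nhds hpos)
  have h5 : 𝓝[>] (0 : ℝ) ≤ 𝓝[≠] 0 := nhdsWithin_mono _ fun t ht => ne_of_gt ht
  filter_upwards [h5 h4, self_mem_nhdsWithin] with t ht htpos
  simp only [slope_def_field, zero_smul, add_zero, h0, sub_zero] at ht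
  exact (div_pos_iff_of_pos_right htpos).1 ht

lemma IsLocalDefiningFunction.eq_zero {E U : Set (EuclideanSpace ℝ (Fin d))}
    {x : EuclideanSpace ℝ (Fin d)} {ψ : EuclideanSpace ℝ (Fin d) → ℝ}
    (hψ : IsLocalDefiningFunction E x U ψ) (hx : x ∈ frontier E) : ψ x = 0 := by
  have hU : U ∈ 𝓝 x := hψ.isOpen.mem_nhds hψ.mem
  have hc : ContinuousAt ψ x := hψ.contDiffOn.continuousOn.continuousAt hU
  rcases lt_trichotomy (ψ x) 0 with h | h | h
  · exact absurd (mem_interior_iff_mem_nhds.2 (by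
      filter_upwards [hU, hc.eventually (gt_mem_nhds h)] with y hy hy'
      exact hψ.neg y hy hy')) hx.2
  · exact h
  · obtain ⟨y, hyE, hy⟩ := ((mem_closure_iff_frequently.1 hx.1).and_eventually
      ((hc.eventually (lt_mem_nhds h)).and hU)).exists
    exact absurd hyE (hψ.pos y hy.2 hy.1)

/-- The outer unit normal does not depend on the local defining function. -/
lemma IsLocalDefiningFunction.normal_unique {E U W : Set (EuclideanSpace ℝ (Fin d))}
    {x : EuclideanSpace ℝ (Fin d)} {ψ χ : EuclideanSpace ℝ (Fin d) → ℝ}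
    (hψ : IsLocalDefiningFunction E x U ψ) (hχ : IsLocalDefiningFunction E x W χ)
    (hx : x ∈ frontier E) :
    ‖gradient ψ x‖⁻¹ • gradient ψ x = ‖gradient χ x‖⁻¹ • gradient χ x := by
  have hU : U ∈ 𝓝 x := hψ.isOpen.mem_nhds hψ.mem
  have hW : W ∈ 𝓝 x := hχ.isOpen.mem_nhds hχ.mem
  have dψ : DifferentiableAt ℝ ψ x := (hψ.contDiffOn.contDiffAt hU).differentiableAt (by norm_num)
  have dχ : DifferentiableAt ℝ χ x := (hχ.contDiffOn.contDiffAt hW).differentiableAt (by norm_num)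
  have nψ : 0 < ‖gradient ψ x‖ := norm_pos_iff.2 (hψ.gradient_ne_zero x hψ.mem)
  have nχ : 0 < ‖gradient χ x‖ := norm_pos_iff.2 (hχ.gradient_ne_zero x hχ.mem)
  by_contra hne
  set a := ‖gradient ψ x‖⁻¹ • gradient ψ x with ha
  set b := ‖gradient χ x‖⁻¹ • gradient χ x with hb
  have na : ‖a‖ = 1 := by rw [ha, norm_smul, norm_inv, norm_norm, inv_mul_cancel₀ nψ.ne']
  have nb : ‖b‖ = 1 := by rw [hb, norm_smul, norm_inv, norm_norm, inv_mul_cancel₀ nχ.ne']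
  have ga : gradient ψ x = ‖gradient ψ x‖ • a := by rw [ha, smul_inv_smul₀ nψ.ne']
  have gb : gradient χ x = ‖gradient χ x‖ • b := by rw [hb, smul_inv_smul₀ nχ.ne']
  have hlt : inner ℝ a b < (1 : ℝ) := (inner_lt_one_iff_real_of_norm_eq_one na nb).2 hne
  have p1 : 0 < inner ℝ (gradient ψ x) (a - b) := by
    rw [ga, real_inner_smul_left, inner_sub_right, real_inner_self_eq_norm_sq, na]
    exact mul_pos nψ (by linarith)
  have p2 : 0 < inner ℝ (gradient (fun y => -χ y) x) (a - b) := by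
    have : gradient (fun y => -χ y) x = -gradient χ x := by
      simp [gradient, fderiv_fun_neg]
    rw [this, gb, inner_neg_left, real_inner_smul_left, inner_sub_right,
      real_inner_self_eq_norm_sq, nb, real_inner_comm, ← mul_neg]
    exact mul_pos nχ (by linarith)
  have e1 := eventually_pos_of_inner_gradient_pos dψ (hψ.eq_zero hx) p1
  have e2 := eventually_pos_of_inner_gradient_pos dχ.fun_neg (by simp [hχ.eq_zero hx]) p2
  have hc : Tendsto (fun t : ℝ => x + t • (a - b)) (𝓝[>] 0) (𝓝 x) := by
    have : Continuous fun t : ℝ => x + t • (a - b) := by fun_prop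
    simpa using (this.tendsto 0).mono_left nhdsWithin_le_nhds
  obtain ⟨t, ⟨h1, h2⟩, h3, h4⟩ := ((e1.and e2).and
    ((hc.eventually hU).and (hc.eventually hW))).exists
  exact hψ.pos _ h3 h1 (hχ.neg _ h4 (by linarith))

lemma outerNormal_eq {E U : Set (EuclideanSpace ℝ (Fin d))}
    {x : EuclideanSpace ℝ (Fin d)} {ψ : EuclideanSpace ℝ (Fin d) → ℝ}
    (hψ : IsLocalDefiningFunction E x U ψ) (hx : x ∈ frontier E) :
    outerNormal E x = ‖gradient ψ x‖⁻¹ • gradient ψ x := by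
  have h : ∃ v U ψ, IsLocalDefiningFunction E x U ψ ∧ v = ‖gradient ψ x‖⁻¹ • gradient ψ x :=
    ⟨_, U, ψ, hψ, rfl⟩
  rw [outerNormal, dif_pos h]
  obtain ⟨W, χ, hχ, hv⟩ := h.choose_spec
  rw [hv]
  exact hχ.normal_unique hψ hx

/-- `∇ν_E(x)`: the tangential derivative of the outer normal along `∂E`, extended by `0` in the
normal direction. The derivative of `ν_E` within the hypersurface `∂E` is determined on the tangent
space only, so it is composed with the orthogonal projection onto `ν_E(x)ᗮ`. -/
def normalGradient (E : Set (EuclideanSpace ℝ (Fin d))) (x : EuclideanSpace ℝ (Fin d)) :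
    EuclideanSpace ℝ (Fin d) →L[ℝ] EuclideanSpace ℝ (Fin d) :=
  (fderivWithin ℝ (outerNormal E) (frontier E) x).comp
    (Submodule.span ℝ {outerNormal E x})ᗮ.starProjection

/-! ### The nonlocal curvature -/

open Classical in
/-- The outer part `κ_ρ⁺(E, x)` of the nonlocal curvature. -/
def kappaPlus (ρ : ℝ) (E : Set (EuclideanSpace ℝ (Fin d))) (x : EuclideanSpace ℝ (Fin d)) : ℝ :=
  if Metric.infDist (x + ρ • outerNormal E x) E = ρ then
    1 / (2 * ρ) * (ContinuousLinearMap.id ℝ _ + ρ • normalGradient E x).det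
  else 0

open Classical in
/-- The inner part `κ_ρ⁻(E, x)` of the nonlocal curvature. -/
def kappaMinus (ρ : ℝ) (E : Set (EuclideanSpace ℝ (Fin d))) (x : EuclideanSpace ℝ (Fin d)) : ℝ :=
  if Metric.infDist (x - ρ • outerNormal E x) Eᶜ = ρ then
    -(1 / (2 * ρ)) * (ContinuousLinearMap.id ℝ _ - ρ • normalGradient E x).det
  else 0

/-- The nonlocal curvature `κ_ρ(E, x)`. -/
def kappa (ρ : ℝ) (E : Set (EuclideanSpace ℝ (Fin d))) (x : EuclideanSpace ℝ (Fin d)) : ℝ :=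
  kappaPlus ρ E x + kappaMinus ρ E x

/-! ### The exceptional set -/

/-- The boundary points from which the full distance to `E` is kept beyond length `ρ` along the
outer normal. -/
def APlus (ρ : ℝ) (E : Set (EuclideanSpace ℝ (Fin d))) : Set (EuclideanSpace ℝ (Fin d)) :=
  {x | x ∈ frontier E ∧ ∃ t > ρ, Metric.infDist (x + t • outerNormal E x) E = t}

/-- The boundary points at which the full distance to `E` is lost before length `ρ` along the
outer normal. -/
def BPlus (ρ : ℝ) (E : Set (EuclideanSpace ℝ (Fin d))) : Set (EuclideanSpace ℝ (Fin d)) :=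
  {x | x ∈ frontier E ∧ Metric.infDist (x + ρ • outerNormal E x) E < ρ}

def NPlus (ρ : ℝ) (E : Set (EuclideanSpace ℝ (Fin d))) : Set (EuclideanSpace ℝ (Fin d)) :=
  frontier E \ (APlus ρ E ∪ BPlus ρ E)

/-- The analogue of `APlus` for the inner normal and the distance to the complement of `E`. -/
def AMinus (ρ : ℝ) (E : Set (EuclideanSpace ℝ (Fin d))) : Set (EuclideanSpace ℝ (Fin d)) :=
  {x | x ∈ frontier E ∧ ∃ t > ρ, Metric.infDist (x - t • outerNormal E x) Eᶜ = t}

/-- The analogue of `BPlus` for the inner normal and the distance to the complement of `E`. -/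
def BMinus (ρ : ℝ) (E : Set (EuclideanSpace ℝ (Fin d))) : Set (EuclideanSpace ℝ (Fin d)) :=
  {x | x ∈ frontier E ∧ Metric.infDist (x - ρ • outerNormal E x) Eᶜ < ρ}

def NMinus (ρ : ℝ) (E : Set (EuclideanSpace ℝ (Fin d))) : Set (EuclideanSpace ℝ (Fin d)) :=
  frontier E \ (AMinus ρ E ∪ BMinus ρ E)

/-- The exceptional set `𝒩_ρ`. -/
def exceptionalSet (ρ : ℝ) (E : Set (EuclideanSpace ℝ (Fin d))) :
    Set (EuclideanSpace ℝ (Fin d)) :=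
  NPlus ρ E ∪ NMinus ρ E

end NonlocalCurvature

end

/-! A ball of radius `ρ` on which the indicator of `F` is essentially constant contributes nothing
to the energy. If both sides of the boundary have interior points near every boundary point, all
other balls contribute exactly `1`. So the energy is `1 / (2ρ)` times the volume of the
`ρ`-neighbourhood of the boundary (`energy_eq_volume`). This two-sidedness passes from `E` to any
homeomorphic image, so no smoothness of the displaced set is needed, and only the values of `Φ ε` on
`frontier E` matter.

The volume of the moving tube is measured in the normal coordinates of the fixed set `E`. Outside
`closure E`, almost every point is `y + s ν(y)` for exactly one pair `(y, s)` with `s` strictly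
before the cut point of the normal at `y`. The area formula then writes the volume as an integral
over `y` of `∫ |det (I + s ∇ν(y))| ds`, where `s` runs over the part of the normal lying in the tube
(`IsClassC2.volume_toReal_eq_integral`).

The derivative is now computed normal by normal. If the cut point of `y` lies beyond `ρ`, this part
of the normal agrees with `(0, ρ + ε φ(y))` up to length `o(ε)`, and the derivative is `det (I + ρ
∇ν(y)) φ(y)`; the determinant is positive because exterior touching balls bound the curvatures from
below (`IsClassC2.normalJac_pos`). If the distance is lost before `ρ`, nothing changes for small
`ε`. The remaining `y` form the exceptional set, which is null by assumption. Since the two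
boundaries are within `C |ε|` of each other, difference quotients are bounded uniformly in `y`, and
dominated convergence gives the outer half (`IsClassC2.hasDerivAt_volume_outer`). The inner half is
the outer half for `Eᶜ` with speed `-φ`, and the boundary itself has volume zero.

The area formula is proved directly for the normal map. On small pieces the hypersurface is almost a
hyperplane, so Fubini along the normal compares the product of surface and Lebesgue measure with
volume, and the normal map becomes a perturbation of a linear map. -/

noncomputable section

namespace NonlocalCurvature

open Module (finrank)
open scoped NNReal

/-! ### Surface measure of almost flat pieces, by slicing with hyperplanes -/

section AreaFormula

set_option linter.unusedSectionVars false

variable {V : Type*} [NormedAddCommGroup V] [InnerProductSpace ℝ V] [FiniteDimensional ℝ V]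
  [MeasurableSpace V] [BorelSpace V]

lemma euclideanHausdorffMeasure_image_le {K : ℝ≥0} {f : V → V} {s : Set V}
    (h : LipschitzOnWith K f s) (n : ℕ) : μHE[n] (f '' s) ≤ (K : ℝ≥0∞) ^ n * μHE[n] s := by
  have := h.hausdorffMeasure_image_le (d := (n : ℝ)) (by positivity)
  rw [Measure.euclideanHausdorffMeasure_def, Measure.smul_apply, Measure.smul_apply,
    mul_smul_comm]
  rw [ENNReal.rpow_natCast] at this
  gcongr

/-- Replace the component of `p.1` along the unit vector `e` by `p.2`. -/
def flatten (e : V) (p : V × ℝ) : V := p.1 - inner ℝ e p.1 • e + p.2 • e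

lemma inner_flatten {e : V} (he : ‖e‖ = 1) (p : V × ℝ) : inner ℝ e (flatten e p) = p.2 := by
  simp [flatten, inner_add_right, inner_sub_right, inner_smul_right, he]

/-- Pythagoras for the splitting into the line along `e` and its orthogonal hyperplane. -/
lemma norm_sq_flatten_sub {e : V} (he : ‖e‖ = 1) (p q : V × ℝ) :
    ‖flatten e p - flatten e q‖ ^ 2 =
      ‖p.1 - q.1‖ ^ 2 - inner ℝ e (p.1 - q.1) ^ 2 + (p.2 - q.2) ^ 2 := by
  have : flatten e p - flatten e q =
      (p.1 - q.1) + ((p.2 - q.2) - inner ℝ e (p.1 - q.1)) • e := by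
    simp only [flatten, inner_sub_right]; module
  rw [this, norm_add_sq_real, norm_smul, he, inner_smul_right, real_inner_comm e (p.1 - q.1)]
  simp only [Real.norm_eq_abs, mul_one, sq_abs]
  ring

@[fun_prop] lemma continuous_flatten (e : V) : Continuous (flatten e) := by
  unfold flatten; fun_prop

/-- `O` is a graph over the hyperplane orthogonal to `e` on which the orthogonal projection
contracts distances by at most `K`. -/
def IsSteep (e : V) (K : ℝ) (O : Set V) : Prop :=
  ∀ y ∈ O, ∀ z ∈ O, ‖y - z‖ ^ 2 ≤ K ^ 2 * (‖y - z‖ ^ 2 - inner ℝ e (y - z) ^ 2)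

lemma IsSteep.norm_sub_le {e : V} (he : ‖e‖ = 1) {K : ℝ} (hK : 0 ≤ K) {O : Set V}
    (hO : IsSteep e K O) {p q : V × ℝ} (hp : p.1 ∈ O) (hq : q.1 ∈ O) :
    ‖p.1 - q.1‖ ≤ K * ‖flatten e p - flatten e q‖ := by
  refine (pow_le_pow_iff_left₀ (by positivity) (by positivity) two_ne_zero).1 ?_
  rw [mul_pow, norm_sq_flatten_sub he]
  refine (hO _ hp _ hq).trans ?_
  gcongr
  nlinarith [sq_nonneg (p.2 - q.2)]

lemma IsSteep.injOn_flatten {e : V} (he : ‖e‖ = 1) {K : ℝ} (hK : 0 ≤ K) {O : Set V}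
    (hO : IsSteep e K O) : InjOn (flatten e) (O ×ˢ univ) := by
  intro p hp q hq hpq
  have h1 := hO.norm_sub_le he hK hp.1 hq.1
  rw [hpq, sub_self, norm_zero, mul_zero] at h1
  have h2 : p.2 = q.2 := by rw [← inner_flatten he p, hpq, inner_flatten he]
  exact Prod.ext (sub_eq_zero.1 (norm_le_zero_iff.1 h1)) h2

lemma lipschitzOnWith_flatten {e : V} (he : ‖e‖ = 1) (t : ℝ) (s : Set V) :
    LipschitzOnWith 1 (fun y => flatten e (y, t)) s := by
  refine LipschitzOnWith.of_dist_le_mul fun y _ z _ => ?_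
  rw [NNReal.coe_one, one_mul, dist_eq_norm, dist_eq_norm]
  refine (pow_le_pow_iff_left₀ (by positivity) (by positivity) two_ne_zero).1 ?_
  rw [norm_sq_flatten_sub he]
  simp only [sub_self]
  nlinarith [sq_nonneg (inner ℝ e (y - z))]

/-- The projection to a hyperplane orthogonal to `e` has a `K`-Lipschitz inverse on a steep set, and
a `K`-Lipschitz map increases `n`-dimensional measure by at most `K ^ n`. -/
lemma IsSteep.measure_le {e : V} (he : ‖e‖ = 1) {K : ℝ≥0} {O s : Set V} (hO : IsSteep e K O)
    (hs : s ⊆ O) (t : ℝ) (n : ℕ) :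
    μHE[n] s ≤ (K : ℝ≥0∞) ^ n * μHE[n] ((fun y => flatten e (y, t)) '' s) := by
  set f : V → V := fun y => flatten e (y, t) with hf
  have hinj : InjOn f s := fun y hy z hz hyz => by
    have := hO.injOn_flatten he K.2 (x₁ := (y, t)) (x₂ := (z, t)) ⟨hs hy, trivial⟩
      ⟨hs hz, trivial⟩ hyz
    exact congrArg Prod.fst this
  have himg : Function.invFunOn f s '' (f '' s) = s := by
    rw [image_image]
    exact (image_congr fun y hy => hinj.leftInvOn_invFunOn hy).trans (image_id _)
  have : LipschitzOnWith K (Function.invFunOn f s) (f '' s) := by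
    refine LipschitzOnWith.of_dist_le_mul ?_
    rintro _ ⟨y, hy, rfl⟩ _ ⟨z, hz, rfl⟩
    rw [hinj.leftInvOn_invFunOn hy, hinj.leftInvOn_invFunOn hz, dist_eq_norm, dist_eq_norm]
    exact hO.norm_sub_le he K.2 (p := (y, t)) (q := (z, t)) (hs hy) (hs hz)
  simpa only [himg] using euclideanHausdorffMeasure_image_le this n

lemma volume_eq_lintegral_slices [Nontrivial V] {e : V} (he : ‖e‖ = 1) {T : Set V}
    (hT : MeasurableSet T) :
    volume T = ∫⁻ t : ℝ, μHE[finrank ℝ V - 1] (T ∩ {y | inner ℝ e y = t}) := by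
  have he0 : e ≠ 0 := by rintro rfl; simp at he
  rw [← InnerProductSpace.euclideanHausdorffMeasure_eq_volume,
    EuclideanGeometry.euclideanHausdorffMeasure_eq_lintegral (0 : V) he0 hT]
  have : ‖e‖ₑ = 1 := by rw [← ofReal_norm, he, ENNReal.ofReal_one]
  rw [this, one_mul]
  congr 1 with t
  congr 2
  ext y
  simp [AffineSubspace.mem_mk', Submodule.mem_orthogonal_singleton_iff_inner_right,
    inner_sub_right, inner_smul_right, he, sub_eq_zero]

/-- Fubini on both sides: the slice of `flatten e '' Z` at height `t` is the projection of the slice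
of `Z` at `t`. The projection is `1`-Lipschitz with a `K`-Lipschitz inverse, so for `K` close to `1`
the map `flatten e` almost preserves measure. -/
lemma IsSteep.volume_flatten_bounds [Nontrivial V] {e : V} (he : ‖e‖ = 1) {K : ℝ≥0}
    {O S : Set V} (hO : IsSteep e K O) (hOS : O ⊆ S)
    (hfin : μHE[finrank ℝ V - 1] S ≠ ∞) {Z : Set (V × ℝ)}
    (hZ : MeasurableSet Z) (hZO : Z ⊆ O ×ˢ univ) :
    volume (flatten e '' Z) ≤
      ((μHE[finrank ℝ V - 1] : Measure V).restrict S).prod volume Z ∧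
    ((μHE[finrank ℝ V - 1] : Measure V).restrict S).prod volume Z ≤
      (K : ℝ≥0∞) ^ (finrank ℝ V - 1) * volume (flatten e '' Z) := by
  set n := finrank ℝ V - 1
  have : Fact ((μHE[n] : Measure V) S < ∞) := ⟨hfin.lt_top⟩
  have hZ' : MeasurableSet (flatten e '' Z) :=
    hZ.image_of_continuousOn_injOn (continuous_flatten e).continuousOn
      ((hO.injOn_flatten he K.2).mono hZO)
  have hslice (t : ℝ) : flatten e '' Z ∩ {y | inner ℝ e y = t} =
      (fun y => flatten e (y, t)) '' ((fun y => (y, t)) ⁻¹' Z) := by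
    ext x
    constructor
    · rintro ⟨⟨p, hp, rfl⟩, hx⟩
      rw [mem_ofPred_eq, inner_flatten he] at hx
      subst hx
      exact ⟨p.1, hp, rfl⟩
    · rintro ⟨y, hy, rfl⟩
      exact ⟨⟨_, hy, rfl⟩, inner_flatten he _⟩
  have hm (t : ℝ) : ((μHE[n] : Measure V).restrict S) ((fun y => (y, t)) ⁻¹' Z) =
      μHE[n] ((fun y => (y, t)) ⁻¹' Z) := by
    rw [Measure.restrict_apply (measurable_prodMk_right hZ), inter_eq_left.2]
    exact fun y hy => hOS (hZO hy).1
  rw [volume_eq_lintegral_slices he hZ', Measure.prod_apply_symm hZ]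
  simp only [hm, hslice]
  constructor
  · refine lintegral_mono fun t => ?_
    simpa using euclideanHausdorffMeasure_image_le (lipschitzOnWith_flatten he t _) n
  · rw [← lintegral_const_mul' _ _ (by finiteness)]
    exact lintegral_mono fun t => hO.measure_le he (fun y hy => (hZO hy).1) t n

/-- A steep bounded set has finite surface measure. -/
lemma IsSteep.measure_lt_top [Nontrivial V] {e : V} (he : ‖e‖ = 1) {K : ℝ≥0} {O : Set V}
    (hO : IsSteep e K O) (hb : Bornology.IsBounded O) : μHE[finrank ℝ V - 1] O < ∞ := by
  have he0 : e ≠ 0 := by rintro rfl; simp at he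
  refine (hO.measure_le he subset_rfl 0 _).trans_lt (ENNReal.mul_lt_top (by finiteness) ?_)
  set W := (ℝ ∙ e)ᗮ
  have hW : finrank ℝ W = finrank ℝ V - 1 := by
    rw [← (ℝ ∙ e).finrank_add_finrank_orthogonal, finrank_span_singleton he0,
      Nat.add_sub_cancel_left]
  have hbd : Bornology.IsBounded ((fun y => flatten e (y, 0)) '' O) :=
    (hb.isCompact_closure.image (by fun_prop : Continuous fun y => flatten e (y, 0))).isBounded.subset
      (image_mono subset_closure)
  obtain ⟨R, hR⟩ := hbd.subset_closedBall 0
  -- At height `0` the projection lands in a ball of the linear hyperplane, where the Hausdorff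
  -- measure of matching dimension is Lebesgue measure.
  have hsub : (fun y => flatten e (y, 0)) '' O ⊆
      ((↑) : W → V) '' (Metric.closedBall (0 : W) R) := by
    rintro _ ⟨y, hy, rfl⟩
    refine ⟨⟨_, (Submodule.mem_orthogonal_singleton_iff_inner_right).2
      (inner_flatten he (y, 0))⟩, ?_, rfl⟩
    have := hR ⟨y, hy, rfl⟩
    simpa using this
  refine (measure_mono hsub).trans_lt ?_
  rw [isometry_subtype_coe.euclideanHausdorffMeasure_image, ← hW]
  exact (isCompact_closedBall _ _).measure_lt_top

end AreaFormula

/-! ### Unit normal fields and the infinitesimal area formula -/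

section NormalField

set_option linter.unusedSectionVars false

variable {V : Type*} [NormedAddCommGroup V] [InnerProductSpace ℝ V] [FiniteDimensional ℝ V]
  [MeasurableSpace V] [BorelSpace V]

/-- `ν` is a unit normal field of class `C¹` on the hypersurface `S`, with strict derivative `A`. -/
structure IsNormalField (S : Set V) (ν : V → V) (A : V → V →L[ℝ] V) : Prop where
  norm_eq_one : ∀ y ∈ S, ‖ν y‖ = 1
  tangent : ∀ x ∈ S, ∀ η > 0, ∃ r > 0, ∀ y ∈ S ∩ Metric.ball x r, ∀ z ∈ S ∩ Metric.ball x r,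
    |inner ℝ (ν x) (y - z)| ≤ η * ‖y - z‖
  strict : ∀ x ∈ S, ∀ η > 0, ∃ r > 0, ∀ y ∈ S ∩ Metric.ball x r, ∀ z ∈ S ∩ Metric.ball x r,
    ‖ν y - ν z - A x (y - z)‖ ≤ η * ‖y - z‖
  apply_normal : ∀ x ∈ S, A x (ν x) = 0
  continuousOn : ContinuousOn A S

/-- The normal map `(y, t) ↦ y + t ν(y)`. -/
def normalMap (ν : V → V) (p : V × ℝ) : V := p.1 + p.2 • ν p.1

/-- The Jacobian of the normal map. -/
def normalJac (A : V → V →L[ℝ] V) (p : V × ℝ) : ℝ :=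
  (ContinuousLinearMap.id ℝ V + p.2 • A p.1).det

/-- The surface measure on `S` times Lebesgue measure. -/
def normalMeasure (S : Set V) : Measure (V × ℝ) :=
  ((μHE[finrank ℝ V - 1] : Measure V).restrict S).prod volume

variable {S : Set V} {ν : V → V} {A : V → V →L[ℝ] V}

lemma isSteep_of_inner_le {e : V} {O : Set V} {K η : ℝ}
    (hKη : 1 ≤ K ^ 2 * (1 - η ^ 2))
    (h : ∀ y ∈ O, ∀ z ∈ O, |inner ℝ e (y - z)| ≤ η * ‖y - z‖) : IsSteep e K O := by
  intro y hy z hz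
  have h1 : inner ℝ e (y - z) ^ 2 ≤ η ^ 2 * ‖y - z‖ ^ 2 := by
    rw [← sq_abs, ← mul_pow]
    exact pow_le_pow_left₀ (abs_nonneg _) (h y hy z hz) 2
  calc ‖y - z‖ ^ 2 ≤ K ^ 2 * (1 - η ^ 2) * ‖y - z‖ ^ 2 := le_mul_of_one_le_left (sq_nonneg _) hKη
    _ = K ^ 2 * (‖y - z‖ ^ 2 - η ^ 2 * ‖y - z‖ ^ 2) := by ring
    _ ≤ _ := by gcongr

lemma IsNormalField.exists_isSteep (h : IsNormalField S ν A) {x : V} (hx : x ∈ S) {K : ℝ}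
    (hK : 1 < K) : ∃ r > 0, IsSteep (ν x) K (S ∩ Metric.ball x r) := by
  -- This tangency constant solves `K ^ 2 * (1 - η ^ 2) = 1`, the borderline case of
  -- `isSteep_of_inner_le`.
  have hη : 0 < Real.sqrt (1 - 1 / K ^ 2) := by
    refine Real.sqrt_pos.2 (sub_pos.2 ?_)
    rw [div_lt_one (by positivity)]
    exact one_lt_pow₀ hK two_ne_zero
  obtain ⟨r, hr, hr'⟩ := h.tangent x hx _ hη
  refine ⟨r, hr, isSteep_of_inner_le ?_ hr'⟩
  rw [Real.sq_sqrt (Real.sqrt_pos.1 hη).le]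
  have : K ≠ 0 := by positivity
  field_simp
  simp

lemma IsNormalField.measure_lt_top [Nontrivial V] (h : IsNormalField S ν A) (hS : IsCompact S) :
    μHE[finrank ℝ V - 1] S < ∞ := by
  refine hS.measure_lt_top_of_nhdsWithin fun x hx => ?_
  obtain ⟨r, hr, hr'⟩ := h.exists_isSteep hx (K := ((2 : ℝ≥0) : ℝ)) (by norm_num)
  exact ⟨_, inter_mem_nhdsWithin S (Metric.ball_mem_nhds x hr),
    hr'.measure_lt_top (h.norm_eq_one x hx) (Metric.isBounded_ball.subset inter_subset_right)⟩

lemma IsNormalField.norm_sub_le (h : IsNormalField S ν A) {x : V} (hx : x ∈ S) :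
    ∃ r > 0, ∀ y ∈ S ∩ Metric.ball x r, ∀ z ∈ S ∩ Metric.ball x r,
      ‖ν y - ν z‖ ≤ (‖A x‖ + 1) * ‖y - z‖ := by
  obtain ⟨r, hr, hr'⟩ := h.strict x hx 1 one_pos
  refine ⟨r, hr, fun y hy z hz => ?_⟩
  calc ‖ν y - ν z‖ = ‖(ν y - ν z - A x (y - z)) + A x (y - z)‖ := by simp
    _ ≤ _ := norm_add_le _ _
    _ ≤ 1 * ‖y - z‖ + ‖A x‖ * ‖y - z‖ := add_le_add (hr' y hy z hz) ((A x).le_opNorm _)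
    _ = _ := by ring

lemma IsNormalField.continuousOn_normal (h : IsNormalField S ν A) : ContinuousOn ν S := by
  intro x hx
  obtain ⟨r, hr, hr'⟩ := h.norm_sub_le hx
  rw [ContinuousWithinAt, tendsto_iff_norm_sub_tendsto_zero]
  have hlim : Tendsto (fun y => (‖A x‖ + 1) * ‖y - x‖) (𝓝[S] x) (𝓝 0) := by
    have : Continuous fun y => (‖A x‖ + 1) * ‖y - x‖ := by fun_prop
    simpa using (this.tendsto x).mono_left nhdsWithin_le_nhds
  refine squeeze_zero' (Eventually.of_forall fun y => norm_nonneg _) ?_ hlim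
  filter_upwards [inter_mem_nhdsWithin S (Metric.ball_mem_nhds x hr)] with y hy
  exact hr' y hy x ⟨hx, Metric.mem_ball_self hr⟩

lemma IsNormalField.continuousOn_normalMap (h : IsNormalField S ν A) :
    ContinuousOn (normalMap ν) (S ×ˢ univ) := by
  unfold normalMap
  have : ContinuousOn (fun p : V × ℝ => ν p.1) (S ×ˢ univ) :=
    h.continuousOn_normal.comp continuousOn_fst fun p hp => hp.1
  exact continuousOn_fst.add (continuousOn_snd.smul this)

lemma IsNormalField.continuousOn_normalJac (h : IsNormalField S ν A) :
    ContinuousOn (normalJac A) (S ×ˢ univ) := by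
  unfold normalJac
  have : ContinuousOn (fun p : V × ℝ => A p.1) (S ×ˢ univ) :=
    h.continuousOn.comp continuousOn_fst fun p hp => hp.1
  exact ContinuousLinearMap.continuous_det.comp_continuousOn
    (continuousOn_const.add (continuousOn_snd.smul this))

/-- An exact form of the linearisation error. With `e = ν x` and `B = A x`, the four terms are small
because of, in order, tangency of the surface, strict differentiability of `ν`, closeness of the
height to `t₀`, and continuity of `ν`. -/
lemma normalMap_sub_eq {e : V} {B : V →L[ℝ] V} (hB : B e = 0) (t₀ : ℝ) (p q : V × ℝ) :
    normalMap ν p - normalMap ν q -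
        (ContinuousLinearMap.id ℝ V + t₀ • B) (flatten e p - flatten e q) =
      inner ℝ e (p.1 - q.1) • e + t₀ • (ν p.1 - ν q.1 - B (p.1 - q.1)) +
        (p.2 - t₀) • (ν p.1 - ν q.1) + (p.2 - q.2) • (ν q.1 - e) := by
  have : flatten e p - flatten e q =
      (p.1 - q.1) + ((p.2 - q.2) - inner ℝ e (p.1 - q.1)) • e := by
    simp only [flatten, inner_sub_right]; module
  rw [this]
  simp only [normalMap, _root_.add_apply, _root_.smul_apply,
    ContinuousLinearMap.id_apply, map_add, map_smul, hB]
  module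

/-- In the coordinates given by `flatten`, the normal map is close to its derivative. -/
lemma IsNormalField.exists_approximates (h : IsNormalField S ν A) {x : V} (hx : x ∈ S) (t₀ : ℝ)
    {δ : ℝ} (hδ : 0 < δ) : ∃ r > 0, ∀ p ∈ (S ∩ Metric.ball x r) ×ˢ Metric.ball t₀ r,
      ∀ q ∈ (S ∩ Metric.ball x r) ×ˢ Metric.ball t₀ r,
      ‖normalMap ν p - normalMap ν q - (ContinuousLinearMap.id ℝ V + t₀ • A x)
        (flatten (ν x) p - flatten (ν x) q)‖ ≤ δ * ‖flatten (ν x) p - flatten (ν x) q‖ := by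
  set L := ‖A x‖ + 1 with hL
  have hL0 : 0 < L := by positivity
  have he := h.norm_eq_one x hx
  -- The first two error terms total `2 * D * η * (1 + |t₀|) = δ * D / 2`. The other two total `3 *
  -- D * r5 * L`, which the choice of `r5` also makes `δ * D / 2`.
  set η := δ / (4 * (1 + |t₀|)) with hη
  have hη0 : 0 < η := by positivity
  obtain ⟨r1, hr1, h1⟩ := h.tangent x hx η hη0
  obtain ⟨r2, hr2, h2⟩ := h.strict x hx η hη0
  obtain ⟨r3, hr3, h3⟩ := h.norm_sub_le hx
  obtain ⟨r4, hr4, h4⟩ := h.exists_isSteep hx one_lt_two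
  set r5 := δ / (6 * L) with hr5
  have hr50 : 0 < r5 := by positivity
  set r := min (min r1 r2) (min (min r3 r4) r5) with hr
  have hr0 : 0 < r := by positivity
  refine ⟨r, hr0, fun p hp q hq => ?_⟩
  have hmem (r' : ℝ) (hrr : r ≤ r') (p : V × ℝ)
      (hp : p ∈ (S ∩ Metric.ball x r) ×ˢ Metric.ball t₀ r) : p.1 ∈ S ∩ Metric.ball x r' :=
    ⟨hp.1.1, Metric.ball_subset_ball hrr hp.1.2⟩
  have e1 : r ≤ r1 := (min_le_left _ _).trans (min_le_left _ _)
  have e2 : r ≤ r2 := (min_le_left _ _).trans (min_le_right _ _)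
  have e3 : r ≤ r3 := (min_le_right _ _).trans ((min_le_left _ _).trans (min_le_left _ _))
  have e4 : r ≤ r4 := (min_le_right _ _).trans ((min_le_left _ _).trans (min_le_right _ _))
  have e5 : r ≤ r5 := (min_le_right _ _).trans (min_le_right _ _)
  set D := ‖flatten (ν x) p - flatten (ν x) q‖ with hD
  have hD0 : 0 ≤ D := norm_nonneg _
  have hw : ‖p.1 - q.1‖ ≤ 2 * D :=
    h4.norm_sub_le he zero_le_two (hmem r4 e4 p hp) (hmem r4 e4 q hq)
  have ht : |p.2 - q.2| ≤ D := by
    rw [← inner_flatten he p, ← inner_flatten he q, ← inner_sub_right]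
    exact (abs_real_inner_le_norm _ _).trans (by rw [he, one_mul])
  have b1 : ‖inner ℝ (ν x) (p.1 - q.1) • ν x‖ ≤ η * (2 * D) := by
    rw [norm_smul, he, mul_one, Real.norm_eq_abs]
    exact (h1 _ (hmem r1 e1 p hp) _ (hmem r1 e1 q hq)).trans (by gcongr)
  have b2 : ‖t₀ • (ν p.1 - ν q.1 - A x (p.1 - q.1))‖ ≤ |t₀| * (η * (2 * D)) := by
    rw [norm_smul, Real.norm_eq_abs]
    gcongr
    exact (h2 _ (hmem r2 e2 p hp) _ (hmem r2 e2 q hq)).trans (by gcongr)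
  have b3 : ‖(p.2 - t₀) • (ν p.1 - ν q.1)‖ ≤ r5 * (L * (2 * D)) := by
    rw [norm_smul]
    have : ‖p.2 - t₀‖ ≤ r5 := by
      rw [← dist_eq_norm]; exact (le_of_lt hp.2).trans e5
    gcongr
    exact (h3 _ (hmem r3 e3 p hp) _ (hmem r3 e3 q hq)).trans (by gcongr)
  have b4 : ‖(p.2 - q.2) • (ν q.1 - ν x)‖ ≤ D * (L * r5) := by
    rw [norm_smul, Real.norm_eq_abs]
    gcongr
    refine (h3 _ (hmem r3 e3 q hq) _ ⟨hx, Metric.mem_ball_self hr3⟩).trans ?_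
    gcongr
    rw [← dist_eq_norm]; exact (le_of_lt hq.1.2).trans e5
  rw [normalMap_sub_eq (h.apply_normal x hx)]
  refine (norm_add₄_le).trans ((add_le_add (add_le_add (add_le_add b1 b2) b3) b4).trans ?_)
  have c1 : η * (1 + |t₀|) = δ / 4 := by
    rw [hη]; field_simp
  have c2 : r5 * L = δ / 6 := by
    rw [hr5]; field_simp
  apply le_of_eq
  linear_combination 2 * D * c1 + 3 * D * c2

/-- Lets the factor `K ^ n` lost in `IsSteep.volume_flatten_bounds` be absorbed by half of the
tolerance. -/
lemma exists_pow_mul_sub_le {a η : ℝ} (hη : 0 < η) (n : ℕ) :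
    ∃ K : ℝ≥0, 1 < (K : ℝ) ∧ (K : ℝ) ^ n * (a - η) ≤ a - η / 2 := by
  have hc : Continuous fun K : ℝ≥0 => (K : ℝ) ^ n * (a - η) := by fun_prop
  have h1 : ∀ᶠ K : ℝ≥0 in 𝓝[>] 1, (K : ℝ) ^ n * (a - η) < a - η / 2 :=
    ((hc.tendsto 1).mono_left nhdsWithin_le_nhds).eventually (gt_mem_nhds (by simp; linarith))
  obtain ⟨K, hK, hK'⟩ := (h1.and self_mem_nhdsWithin).exists
  exact ⟨K, by exact_mod_cast hK', hK.le⟩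

/-- Infinitesimal form of the area formula for the normal map. -/
lemma IsNormalField.exists_volume_image_bounds [Nontrivial V] (h : IsNormalField S ν A)
    (hS : IsCompact S) {x : V} (hx : x ∈ S) (t₀ : ℝ) {η : ℝ} (hη : 0 < η) :
    ∃ r > 0, ∀ Z ⊆ (S ∩ Metric.ball x r) ×ˢ Metric.ball t₀ r, MeasurableSet Z →
      volume (normalMap ν '' Z) ≤
        ENNReal.ofReal (|normalJac A (x, t₀)| + η) * normalMeasure S Z ∧
      ENNReal.ofReal |normalJac A (x, t₀)| * normalMeasure S Z ≤
        volume (normalMap ν '' Z) + ENNReal.ofReal η * normalMeasure S Z := by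
  have he := h.norm_eq_one x hx
  set B := ContinuousLinearMap.id ℝ V + t₀ • A x with hB
  set a := |normalJac A (x, t₀)| with ha
  have haB : a = |B.det| := rfl
  have ha0 : 0 ≤ a := abs_nonneg _
  set n := finrank ℝ V - 1
  -- The lower bound has content only for `η < a`; otherwise the error term alone exceeds the left
  -- side, which also covers a vanishing Jacobian.
  obtain ⟨K, hK1, hK⟩ : ∃ K : ℝ≥0, 1 < (K : ℝ) ∧ (η < a → (K : ℝ) ^ n * (a - η) ≤ a - η / 2) := by
    by_cases hηa : η < a
    · obtain ⟨K, h1, h2⟩ := exists_pow_mul_sub_le (a := a) hη n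
      exact ⟨K, h1, fun _ => h2⟩
    · exact ⟨2, by norm_num, fun h => absurd h hηa⟩
  have hup := addHaar_image_le_mul_of_det_lt (volume : Measure V) B (m := (a + η).toNNReal)
    ((ENNReal.ofReal_lt_ofReal_iff (by positivity)).2 (by rw [← haB]; linarith))
  have hlo : η < a → ∀ᶠ δ : ℝ≥0 in 𝓝[>] 0, ∀ (s : Set V) (f : V → V),
      ApproximatesLinearOn f B s δ →
        ((a - η / 2).toNNReal : ℝ≥0∞) * volume s ≤ volume (f '' s) := fun _ =>
    mul_le_addHaar_image_of_lt_det (volume : Measure V) B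
      ((ENNReal.ofReal_lt_ofReal_iff (by linarith)).2 (by rw [← haB]; linarith))
  obtain ⟨δ, ⟨hδ1, hδ2⟩, hδ0⟩ := ((hup.and (eventually_imp_distrib_left.2 hlo)).and
    self_mem_nhdsWithin).exists
  obtain ⟨r1, hr1, h1⟩ := h.exists_approximates hx t₀ (δ := δ) hδ0
  obtain ⟨r2, hr2, h2⟩ := h.exists_isSteep hx hK1
  refine ⟨min r1 r2, by positivity, fun Z hZ hZm => ?_⟩
  have hZ1 : Z ⊆ (S ∩ Metric.ball x r1) ×ˢ Metric.ball t₀ r1 := hZ.trans (prod_mono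
    (inter_subset_inter_right _ (Metric.ball_subset_ball (min_le_left _ _)))
    (Metric.ball_subset_ball (min_le_left _ _)))
  have hZ2 : Z ⊆ (S ∩ Metric.ball x r2) ×ˢ univ := hZ.trans (prod_mono
    (inter_subset_inter_right _ (Metric.ball_subset_ball (min_le_right _ _))) (subset_univ _))
  have hinj : InjOn (flatten (ν x)) Z := (h2.injOn_flatten he K.2).mono hZ2
  obtain ⟨v1, v2⟩ := h2.volume_flatten_bounds he inter_subset_left (h.measure_lt_top hS).ne hZm hZ2
  -- The normal map read in flattened coordinates is a self-map of `V` close to the linear map `B`,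
  -- so the determinant estimates for volumes apply to it.
  set f : V → V := fun y => normalMap ν (Function.invFunOn (flatten (ν x)) Z y) with hf
  have himg : f '' (flatten (ν x) '' Z) = normalMap ν '' Z := by
    rw [image_image]
    exact image_congr fun p hp => by rw [hf]; simp only [hinj.leftInvOn_invFunOn hp]
  have happ : ApproximatesLinearOn f B (flatten (ν x) '' Z) δ := by
    rintro _ ⟨p, hp, rfl⟩ _ ⟨q, hq, rfl⟩
    simp only [hf, hinj.leftInvOn_invFunOn hp, hinj.leftInvOn_invFunOn hq]
    exact h1 p (hZ1 hp) q (hZ1 hq)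
  constructor
  · rw [← himg]
    exact (hδ1 _ _ happ).trans (mul_le_mul_right v1 _)
  · rcases lt_or_ge η a with hηa | hηa
    · have k1 := hδ2 hηa _ _ happ
      rw [himg] at k1
      calc ENNReal.ofReal a * normalMeasure S Z
          = ENNReal.ofReal (a - η) * normalMeasure S Z + ENNReal.ofReal η * normalMeasure S Z := by
            rw [← add_mul, ← ENNReal.ofReal_add (by linarith) hη.le, sub_add_cancel]
        _ ≤ _ := by
            gcongr
            calc ENNReal.ofReal (a - η) * normalMeasure S Z
                ≤ ENNReal.ofReal (a - η) * ((K : ℝ≥0∞) ^ n * volume (flatten (ν x) '' Z)) := by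
                  gcongr; exact v2
              _ = ENNReal.ofReal (K ^ n * (a - η)) * volume (flatten (ν x) '' Z) := by
                  rw [← mul_assoc, ENNReal.ofReal_mul (by positivity),
                    ENNReal.ofReal_pow (by positivity), ENNReal.ofReal_coe_nnreal,
                    mul_comm (ENNReal.ofReal (a - η))]
              _ ≤ ENNReal.ofReal (a - η / 2) * volume (flatten (ν x) '' Z) := by
                  gcongr; exact hK hηa
              _ ≤ _ := k1
    · exact (mul_le_mul_left (ENNReal.ofReal_le_ofReal hηa) _).trans le_add_self

end NormalField

/-! ### The area formula for the normal map -/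

section AreaFormulaGlobal

set_option linter.unusedSectionVars false

variable {V : Type*} [NormedAddCommGroup V] [InnerProductSpace ℝ V] [FiniteDimensional ℝ V]
  [MeasurableSpace V] [BorelSpace V] {S : Set V} {ν : V → V} {A : V → V →L[ℝ] V}

/-- Near `p` the Jacobian varies by at most `η`, so its value at `p` may be replaced by its integral
at the price of a second `η`. -/
lemma IsNormalField.exists_volume_image_lintegral_bounds [Nontrivial V]
    (h : IsNormalField S ν A) (hS : IsCompact S) {p : V × ℝ} (hp : p.1 ∈ S) {η : ℝ} (hη : 0 < η) :
    ∃ U ∈ 𝓝 p, IsOpen U ∧ ∀ Z ⊆ U ∩ S ×ˢ univ, MeasurableSet Z →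
      volume (normalMap ν '' Z) ≤
        (∫⁻ q in Z, ENNReal.ofReal |normalJac A q| ∂normalMeasure S) +
          ENNReal.ofReal (2 * η) * normalMeasure S Z ∧
      (∫⁻ q in Z, ENNReal.ofReal |normalJac A q| ∂normalMeasure S) ≤
        volume (normalMap ν '' Z) + ENNReal.ofReal (2 * η) * normalMeasure S Z := by
  obtain ⟨x, t₀⟩ := p
  obtain ⟨r, hr, hr'⟩ := h.exists_volume_image_bounds hS hp t₀ hη
  have hc := h.continuousOn_normalJac.abs (x, t₀) ⟨hp, trivial⟩
  obtain ⟨W, hWo, hpW, hW⟩ := mem_nhdsWithin.1 (hc.preimage_mem_nhdsWithin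
    (Metric.closedBall_mem_nhds _ hη))
  refine ⟨W ∩ Metric.ball x r ×ˢ Metric.ball t₀ r,
    inter_mem (hWo.mem_nhds hpW) (prod_mem_nhds (Metric.ball_mem_nhds _ hr)
      (Metric.ball_mem_nhds _ hr)), hWo.inter (Metric.isOpen_ball.prod Metric.isOpen_ball),
    fun Z hZ hZm => ?_⟩
  have hJ : ∀ q ∈ Z, |(|normalJac A q| - |normalJac A (x, t₀)|)| ≤ η := fun q hq => by
    have := hW ⟨(hZ hq).1.1, (hZ hq).2⟩
    rwa [mem_preimage, Metric.mem_closedBall, Real.dist_eq] at this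
  obtain ⟨h1, h2⟩ := hr' Z (fun q hq => ⟨⟨(hZ hq).2.1, (hZ hq).1.2.1⟩, (hZ hq).1.2.2⟩) hZm
  set a := |normalJac A (x, t₀)| with ha
  have ha0 : 0 ≤ a := abs_nonneg _
  have k1 : ENNReal.ofReal a * normalMeasure S Z ≤
      (∫⁻ q in Z, ENNReal.ofReal |normalJac A q| ∂normalMeasure S) +
        ENNReal.ofReal η * normalMeasure S Z := by
    rw [← setLIntegral_const, ← setLIntegral_const, ← lintegral_add_right _ measurable_const]
    refine setLIntegral_mono' hZm fun q hq => ?_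
    rw [← ENNReal.ofReal_add (abs_nonneg _) hη.le]
    exact ENNReal.ofReal_le_ofReal (by linarith [(abs_le.1 (hJ q hq)).1])
  have k2 : (∫⁻ q in Z, ENNReal.ofReal |normalJac A q| ∂normalMeasure S) ≤
      ENNReal.ofReal a * normalMeasure S Z + ENNReal.ofReal η * normalMeasure S Z := by
    rw [← add_mul, ← ENNReal.ofReal_add ha0 hη.le, ← setLIntegral_const]
    refine setLIntegral_mono' hZm fun q hq => ?_
    exact ENNReal.ofReal_le_ofReal (by linarith [(abs_le.1 (hJ q hq)).2])
  have e : ENNReal.ofReal (2 * η) * normalMeasure S Z =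
      ENNReal.ofReal η * normalMeasure S Z + ENNReal.ofReal η * normalMeasure S Z := by
    rw [two_mul, ENNReal.ofReal_add hη.le hη.le, add_mul]
  rw [e, ← add_assoc, ← add_assoc]
  constructor
  · refine h1.trans ?_
    rw [ENNReal.ofReal_add ha0 hη.le, add_mul]
    gcongr
  · exact k2.trans (by gcongr)

/-- Lindelöf extracts countably many of the good neighbourhoods, and disjointing them keeps the
local bounds, which hold for every measurable subset. The errors then sum to `2 * η` times the
measure of `Z`. -/
lemma IsNormalField.exists_partition [Nontrivial V] (h : IsNormalField S ν A) (hS : IsCompact S)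
    {η : ℝ} (hη : 0 < η) {Z : Set (V × ℝ)} (hZ : Z ⊆ S ×ˢ univ) (hZm : MeasurableSet Z) :
    ∃ Y : ℕ → Set (V × ℝ), (∀ i, MeasurableSet (Y i)) ∧ Pairwise (Function.onFun Disjoint Y) ∧
      Z = ⋃ i, Y i ∧ ∀ i,
      volume (normalMap ν '' Y i) ≤
        (∫⁻ q in Y i, ENNReal.ofReal |normalJac A q| ∂normalMeasure S) +
          ENNReal.ofReal (2 * η) * normalMeasure S (Y i) ∧
      (∫⁻ q in Y i, ENNReal.ofReal |normalJac A q| ∂normalMeasure S) ≤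
        volume (normalMap ν '' Y i) + ENNReal.ofReal (2 * η) * normalMeasure S (Y i) := by
  choose! U hU hUo hUb using fun (p : V × ℝ) (hp : p.1 ∈ S) =>
    h.exists_volume_image_lintegral_bounds hS hp hη
  rcases Z.eq_empty_or_nonempty with rfl | hne
  · refine ⟨fun _ => ∅, by simp, ?_, by simp, by simp⟩
    intro i j _
    simp [Function.onFun]
  obtain ⟨T, hTZ, hTc, hT⟩ := TopologicalSpace.countable_cover_nhdsWithin
    fun p (hp : p ∈ Z) => mem_nhdsWithin_of_mem_nhds (hU p (hZ hp).1)
  have hTne : T.Nonempty := by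
    by_contra hT0
    rw [not_nonempty_iff_eq_empty.1 hT0] at hT
    obtain ⟨z, hz⟩ := hne
    simpa using hT hz
  obtain ⟨g, rfl⟩ := hTc.exists_eq_range hTne
  have hg (i : ℕ) : (g i).1 ∈ S := (hZ (hTZ (mem_range_self i))).1
  have hm (i : ℕ) : MeasurableSet (Z ∩ disjointed (fun i => U (g i)) i) :=
    hZm.inter (MeasurableSet.disjointed (fun i => (hUo _ (hg i)).measurableSet) i)
  refine ⟨fun i => Z ∩ disjointed (fun i => U (g i)) i, hm, ?_, ?_, fun i => ?_⟩
  · intro i j hij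
    exact (disjoint_disjointed _ hij).mono inter_subset_right inter_subset_right
  · rw [← inter_iUnion, iUnion_disjointed, eq_comm, inter_eq_left]
    simpa using hT
  · exact hUb _ (hg i) _ (fun q hq => ⟨disjointed_subset (fun i => U (g i)) i hq.2, hZ hq.1⟩) (hm i)

lemma le_of_forall_le_add_ofReal_mul {a b c : ℝ≥0∞} (hc : c ≠ ∞)
    (h : ∀ η : ℝ, 0 < η → a ≤ b + ENNReal.ofReal (2 * η) * c) : a ≤ b := by
  have hlim : Tendsto (fun η : ℝ => b + ENNReal.ofReal (2 * η) * c) (𝓝[>] 0) (𝓝 b) := by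
    have h1 : Tendsto (fun η : ℝ => ENNReal.ofReal (2 * η)) (𝓝[>] 0) (𝓝 0) := by
      have : Continuous fun η : ℝ => ENNReal.ofReal (2 * η) :=
        ENNReal.continuous_ofReal.comp (by fun_prop)
      simpa using (this.tendsto 0).mono_left nhdsWithin_le_nhds
    simpa using (ENNReal.Tendsto.mul_const h1 (Or.inr hc)).const_add b
  refine ge_of_tendsto hlim ?_
  filter_upwards [self_mem_nhdsWithin] with η hη using h η hη

/-- The area formula for the normal map, upper bound without injectivity. -/
theorem IsNormalField.volume_image_le [Nontrivial V] (h : IsNormalField S ν A) (hS : IsCompact S)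
    {Z : Set (V × ℝ)} (hZ : Z ⊆ S ×ˢ univ) (hZm : MeasurableSet Z)
    (hfin : normalMeasure S Z ≠ ∞) :
    volume (normalMap ν '' Z) ≤ ∫⁻ q in Z, ENNReal.ofReal |normalJac A q| ∂normalMeasure S := by
  refine le_of_forall_le_add_ofReal_mul hfin fun η hη => ?_
  obtain ⟨Y, hYm, hYd, rfl, hY⟩ := h.exists_partition hS hη hZ hZm
  rw [image_iUnion, lintegral_iUnion hYm hYd, measure_iUnion hYd hYm, ← ENNReal.tsum_mul_left,
    ← ENNReal.tsum_add]
  exact (measure_iUnion_le _).trans (ENNReal.tsum_le_tsum fun i => (hY i).1)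

/-- The area formula for the normal map. -/
theorem IsNormalField.volume_image_eq [Nontrivial V] (h : IsNormalField S ν A) (hS : IsCompact S)
    {Z : Set (V × ℝ)} (hZ : Z ⊆ S ×ˢ univ) (hZm : MeasurableSet Z)
    (hfin : normalMeasure S Z ≠ ∞) (hinj : InjOn (normalMap ν) Z) :
    volume (normalMap ν '' Z) = ∫⁻ q in Z, ENNReal.ofReal |normalJac A q| ∂normalMeasure S := by
  refine le_antisymm (h.volume_image_le hS hZ hZm hfin)
    (le_of_forall_le_add_ofReal_mul hfin fun η hη => ?_)
  obtain ⟨Y, hYm, hYd, rfl, hY⟩ := h.exists_partition hS hη hZ hZm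
  have hsub (i : ℕ) : Y i ⊆ ⋃ i, Y i := subset_iUnion Y i
  rw [image_iUnion, lintegral_iUnion hYm hYd, measure_iUnion hYd hYm, measure_iUnion,
    ← ENNReal.tsum_mul_left, ← ENNReal.tsum_add]
  · exact ENNReal.tsum_le_tsum fun i => (hY i).2
  · intro i j hij
    refine disjoint_left.2 ?_
    rintro _ ⟨p, hp, rfl⟩ ⟨q, hq, hpq⟩
    rw [hinj (hsub j hq) (hsub i hp) hpq] at hq
    exact disjoint_left.1 (hYd hij) hp hq
  · exact fun i => (hYm i).image_of_continuousOn_injOn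
      (h.continuousOn_normalMap.mono ((hsub i).trans hZ)) (hinj.mono (hsub i))

end AreaFormulaGlobal

/-! ### The normal field of a set of class C² -/

section Geometry

set_option linter.unusedSectionVars false

/-- Otherwise the interiors of `E` and `Eᶜ` would disconnect `C`. -/
lemma inter_frontier_nonempty {X : Type*} [TopologicalSpace X] {C E : Set X}
    (hC : IsPreconnected C) (h1 : (C ∩ E).Nonempty) (h2 : (C ∩ Eᶜ).Nonempty) :
    (C ∩ frontier E).Nonempty := by
  by_contra h
  rw [not_nonempty_iff_eq_empty, ← disjoint_iff_inter_eq_empty, disjoint_left] at h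
  have hcov : C ⊆ interior E ∪ interior Eᶜ := fun x hx => by
    by_contra hx'
    rw [mem_union, not_or, interior_compl, mem_compl_iff, not_not] at hx'
    exact h hx ⟨hx'.2, hx'.1⟩
  obtain ⟨x, hx, hx1, hx2⟩ := hC _ _ isOpen_interior isOpen_interior hcov
    (h1.imp fun x hx => ⟨hx.1, (hcov hx.1).resolve_right fun h => interior_subset h hx.2⟩)
    (h2.imp fun x hx => ⟨hx.1, (hcov hx.1).resolve_left fun h => hx.2 (interior_subset h)⟩)
  exact interior_subset hx2 (interior_subset hx1)

variable {d : ℕ} {E U : Set (EuclideanSpace ℝ (Fin d))} {x : EuclideanSpace ℝ (Fin d)}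
  {ψ : EuclideanSpace ℝ (Fin d) → ℝ}

lemma starProjection_orthogonal_singleton {u : EuclideanSpace ℝ (Fin d)} (hu : ‖u‖ = 1)
    (v : EuclideanSpace ℝ (Fin d)) :
    (Submodule.span ℝ {u})ᗮ.starProjection v = v - inner ℝ u v • u := by
  rw [Submodule.starProjection_orthogonal, _root_.sub_apply, ContinuousLinearMap.id_apply,
    Submodule.starProjection_unit_singleton ℝ hu]

/-- The normalised gradient. -/
def unitGradient (ψ : EuclideanSpace ℝ (Fin d) → ℝ) (y : EuclideanSpace ℝ (Fin d)) :
    EuclideanSpace ℝ (Fin d) := ‖gradient ψ y‖⁻¹ • gradient ψ y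

namespace IsLocalDefiningFunction

variable (h : IsLocalDefiningFunction E x U ψ)
include h

lemma of_mem {y : EuclideanSpace ℝ (Fin d)} (hy : y ∈ U) : IsLocalDefiningFunction E y U ψ :=
  { h with mem := hy }

lemma compl : IsLocalDefiningFunction Eᶜ x U (fun y => -ψ y) where
  isOpen := h.isOpen
  mem := h.mem
  contDiffOn := h.contDiffOn.neg
  gradient_ne_zero y hy := by
    have : gradient (fun y => -ψ y) y = -gradient ψ y := by simp [gradient, fderiv_fun_neg]
    rw [this, neg_ne_zero]
    exact h.gradient_ne_zero y hy
  neg y hy hn := h.pos y hy (by linarith)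
  pos y hy hp := fun hc => hc (h.neg y hy (by linarith))

lemma differentiableAt : DifferentiableAt ℝ ψ x :=
  (h.contDiffOn.contDiffAt (h.isOpen.mem_nhds h.mem)).differentiableAt (by norm_num)

lemma hasStrictFDerivAt : HasStrictFDerivAt ψ (fderiv ℝ ψ x) x :=
  (h.contDiffOn.contDiffAt (h.isOpen.mem_nhds h.mem)).hasStrictFDerivAt (by norm_num)

lemma norm_gradient_pos : 0 < ‖gradient ψ x‖ := norm_pos_iff.2 (h.gradient_ne_zero x h.mem)

lemma norm_unitGradient : ‖unitGradient ψ x‖ = 1 := by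
  rw [unitGradient, norm_smul, norm_inv, norm_norm, inv_mul_cancel₀ h.norm_gradient_pos.ne']

lemma gradient_eq_smul : gradient ψ x = ‖gradient ψ x‖ • unitGradient ψ x := by
  rw [unitGradient, smul_inv_smul₀ h.norm_gradient_pos.ne']

lemma contDiffOn_unitGradient : ContDiffOn ℝ 1 (unitGradient ψ) U := by
  have h1 : ContDiffOn ℝ 1 (fderiv ℝ ψ) U :=
    h.contDiffOn.fderiv_of_isOpen h.isOpen (by norm_num)
  have h2 : ContDiffOn ℝ 1 (gradient ψ) U :=
    ((InnerProductSpace.toDual ℝ (EuclideanSpace ℝ (Fin d))).symm.contDiff).comp_contDiffOn h1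
  exact ((h2.norm ℝ h.gradient_ne_zero).inv
    fun y hy => norm_ne_zero_iff.2 (h.gradient_ne_zero y hy)).smul h2

lemma hasStrictFDerivAt_unitGradient :
    HasStrictFDerivAt (unitGradient ψ) (fderiv ℝ (unitGradient ψ) x) x :=
  (h.contDiffOn_unitGradient.contDiffAt (h.isOpen.mem_nhds h.mem)).hasStrictFDerivAt (by norm_num)

lemma outerNormal_eqOn : EqOn (outerNormal E) (unitGradient ψ) (frontier E ∩ U) :=
  fun _ hy => outerNormal_eq (h.of_mem hy.2) hy.1

lemma eventually_notMem (hx : x ∈ frontier E) {v : EuclideanSpace ℝ (Fin d)}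
    (hv : 0 < inner ℝ (unitGradient ψ x) v) : ∀ᶠ r : ℝ in 𝓝[>] 0, x + r • v ∉ E := by
  have hv' : 0 < inner ℝ (gradient ψ x) v := by
    rw [h.gradient_eq_smul, real_inner_smul_left]
    exact mul_pos h.norm_gradient_pos hv
  have hc : Tendsto (fun r : ℝ => x + r • v) (𝓝[>] 0) (𝓝 x) := by
    have : Continuous fun r : ℝ => x + r • v := by fun_prop
    simpa using (this.tendsto 0).mono_left nhdsWithin_le_nhds
  filter_upwards [eventually_pos_of_inner_gradient_pos h.differentiableAt (h.eq_zero hx) hv',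
    hc.eventually (h.isOpen.mem_nhds h.mem)] with r h1 h2
  exact h.pos _ h2 h1

lemma unitGradient_neg : unitGradient (fun y => -ψ y) = -unitGradient ψ := by
  ext1 y
  have : gradient (fun y => -ψ y) y = -gradient ψ y := by simp [gradient, fderiv_fun_neg]
  simp [unitGradient, this]

lemma eventually_mem (hx : x ∈ frontier E) {v : EuclideanSpace ℝ (Fin d)}
    (hv : inner ℝ (unitGradient ψ x) v < 0) : ∀ᶠ r : ℝ in 𝓝[>] 0, x + r • v ∈ E := by
  have := h.compl.eventually_notMem (frontier_compl E ▸ hx) (v := v)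
    (by rw [h.unitGradient_neg, Pi.neg_apply, inner_neg_left]; linarith)
  simpa using this

/-- Every direction orthogonal to the gradient is tangent to the boundary. -/
lemma eventually_exists_frontier (hx : x ∈ frontier E) {v : EuclideanSpace ℝ (Fin d)}
    (hv : inner ℝ (unitGradient ψ x) v = 0) {η : ℝ} (hη : 0 < η) :
    ∀ᶠ r : ℝ in 𝓝[>] 0, ∃ y ∈ frontier E, ‖y - x - r • v‖ ≤ r * η := by
  have hn := h.norm_unitGradient
  set e := unitGradient ψ x
  have h1 := h.eventually_notMem hx (v := v + η • e)
    (by rw [inner_add_right, hv, real_inner_smul_right, real_inner_self_eq_norm_sq, hn]; simpa)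
  have h2 := h.eventually_mem hx (v := v - η • e)
    (by rw [inner_sub_right, hv, real_inner_smul_right, real_inner_self_eq_norm_sq, hn]; simpa)
  filter_upwards [h1, h2, self_mem_nhdsWithin] with r hr1 hr2 hr
  replace hr : 0 < r := hr
  -- The small ball about `x + r • v` contains a point of `E` and a point of `Eᶜ`, reached by
  -- tilting `v` by `η` inwards and outwards.
  obtain ⟨y, hy, hyE⟩ := inter_frontier_nonempty
    (convex_closedBall (x + r • v) (r * η)).isPreconnected
    ⟨_, by simp [smul_sub, norm_smul, hn, abs_of_pos hr, abs_of_pos hη], hr2⟩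
    ⟨_, by simp [smul_add, norm_smul, hn, abs_of_pos hr, abs_of_pos hη], hr1⟩
  refine ⟨y, hyE, ?_⟩
  rw [Metric.mem_closedBall, dist_eq_norm] at hy
  rwa [sub_sub]

/-- A derivative within `frontier E` is determined only on the tangent cone. This inclusion makes
the tangential derivative of the normal independent of the choice made by `fderivWithin`. -/
lemma mem_tangentConeAt (hx : x ∈ frontier E) {v : EuclideanSpace ℝ (Fin d)}
    (hv : inner ℝ (unitGradient ψ x) v = 0) : v ∈ tangentConeAt ℝ (frontier E) x := by
  have key (n : ℕ) : ∃ r : ℝ, 0 < r ∧ r < 1 / ((n : ℝ) + 1) ∧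
      ∃ y ∈ frontier E, ‖y - x - r • v‖ ≤ r * (1 / ((n : ℝ) + 1)) := by
    have hn : (0 : ℝ) < 1 / ((n : ℝ) + 1) := by positivity
    obtain ⟨r, h1, h2, h3⟩ := ((h.eventually_exists_frontier hx hv hn).and
      (Ioo_mem_nhdsGT hn)).exists
    exact ⟨r, h2, h3, h1⟩
  choose r hr hrn y hy hyn using key
  have h0 : Tendsto (fun n : ℕ => 1 / ((n : ℝ) + 1)) atTop (𝓝 0) :=
    tendsto_one_div_add_atTop_nhds_zero_nat
  refine mem_tangentConeAt_of_seq atTop (fun n => (r n)⁻¹) (fun n => y n - x) ?_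
    (Eventually.of_forall fun n => by simpa using hy n) ?_
  · have hlim : Tendsto (fun n : ℕ => 1 / ((n : ℝ) + 1) * (1 + ‖v‖)) atTop (𝓝 0) := by
      simpa using h0.mul_const (1 + ‖v‖)
    refine squeeze_zero_norm (fun n => ?_) hlim
    have hn1 : 1 / ((n : ℝ) + 1) ≤ 1 := by
      rw [div_le_one (by positivity)]; simp
    calc ‖y n - x‖ = ‖(y n - x - r n • v) + r n • v‖ := by simp
      _ ≤ r n * (1 / ((n : ℝ) + 1)) + r n * ‖v‖ := by
        refine (norm_add_le _ _).trans (add_le_add (hyn n) ?_)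
        rw [norm_smul, Real.norm_of_nonneg (hr n).le]
      _ ≤ r n * 1 + r n * ‖v‖ := by gcongr; exact (hr n).le
      _ = r n * (1 + ‖v‖) := by ring
      _ ≤ _ := by gcongr; exact (hrn n).le
  · rw [tendsto_iff_norm_sub_tendsto_zero]
    refine squeeze_zero (fun n => norm_nonneg _) (fun n => ?_) h0
    have : (r n)⁻¹ • (y n - x) - v = (r n)⁻¹ • (y n - x - r n • v) := by
      rw [smul_sub _ (y n - x), inv_smul_smul₀ (hr n).ne']
    rw [this, norm_smul, norm_inv, Real.norm_of_nonneg (hr n).le,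
      inv_mul_le_iff₀ (hr n)]
    exact hyn n

lemma normalGradient_apply (hx : x ∈ frontier E) (v : EuclideanSpace ℝ (Fin d)) :
    normalGradient E x v = fderiv ℝ (unitGradient ψ) x
      (v - inner ℝ (unitGradient ψ x) v • unitGradient ψ x) := by
  have hν : outerNormal E x = unitGradient ψ x := outerNormal_eq h hx
  rw [normalGradient, ContinuousLinearMap.comp_apply,
    starProjection_orthogonal_singleton (hν ▸ h.norm_unitGradient), hν]
  have hd : HasFDerivWithinAt (outerNormal E) (fderiv ℝ (unitGradient ψ) x) (frontier E) x := by
    refine h.hasStrictFDerivAt_unitGradient.hasFDerivAt.hasFDerivWithinAt.congr_of_eventuallyEq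
      ?_ hν
    filter_upwards [inter_mem_nhdsWithin _ (h.isOpen.mem_nhds h.mem)] with y hy
    exact h.outerNormal_eqOn hy
  refine hd.differentiableWithinAt.hasFDerivWithinAt.unique_on hd (h.mem_tangentConeAt hx ?_)
  rw [inner_sub_right, real_inner_smul_right, real_inner_self_eq_norm_sq, h.norm_unitGradient]
  ring

end IsLocalDefiningFunction

lemma IsClassC2.compl (hE : IsClassC2 E) : IsClassC2 Eᶜ := fun x hx => by
  obtain ⟨U, ψ, h⟩ := hE x (frontier_compl E ▸ hx)
  exact ⟨U, _, h.compl⟩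

lemma outerNormal_compl (hE : IsClassC2 E) (hx : x ∈ frontier E) :
    outerNormal Eᶜ x = -outerNormal E x := by
  obtain ⟨U, ψ, h⟩ := hE x hx
  have h1 : outerNormal Eᶜ x = unitGradient (fun y => -ψ y) x :=
    outerNormal_eq h.compl (frontier_compl E ▸ hx)
  have h2 : outerNormal E x = unitGradient ψ x := outerNormal_eq h hx
  rw [h1, h2, h.unitGradient_neg, Pi.neg_apply]

lemma normalGradient_compl (hE : IsClassC2 E) (hx : x ∈ frontier E) :
    normalGradient Eᶜ x = -normalGradient E x := by
  obtain ⟨U, ψ, h⟩ := hE x hx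
  ext1 v
  rw [h.compl.normalGradient_apply (frontier_compl E ▸ hx), _root_.neg_apply,
    h.normalGradient_apply hx, h.unitGradient_neg]
  simp [fderiv_neg]

/-- The outer normal of a set of class `C²` is a `C¹` unit normal field. -/
theorem IsClassC2.isNormalField (hE : IsClassC2 E) :
    IsNormalField (frontier E) (outerNormal E) (normalGradient E) where
  norm_eq_one x hx := by
    obtain ⟨U, ψ, h⟩ := hE x hx
    exact (congrArg norm (outerNormal_eq h hx)).trans h.norm_unitGradient
  tangent x hx η hη := by
    obtain ⟨U, ψ, h⟩ := hE x hx
    -- As `ψ` vanishes at both boundary points, strict differentiability leaves only the linear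
    -- term, so differences of boundary points are almost orthogonal to the gradient.
    have h1 := h.hasStrictFDerivAt.isLittleO.def (mul_pos hη h.norm_gradient_pos)
    rw [nhds_prod_eq] at h1
    obtain ⟨r, hr, hr'⟩ := (Metric.nhds_basis_ball.prod_self.eventually_iff).1
      (h1.and (prod_mem_prod (h.isOpen.mem_nhds h.mem) (h.isOpen.mem_nhds h.mem)))
    refine ⟨r, hr, fun y hy z hz => ?_⟩
    obtain ⟨k1, ky, kz⟩ := hr' (x := (y, z)) ⟨hy.2, hz.2⟩
    dsimp only at k1 ky kz
    rw [(h.of_mem ky).eq_zero hy.1, (h.of_mem kz).eq_zero hz.1, sub_zero, zero_sub, norm_neg,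
      ← inner_gradient_left, h.gradient_eq_smul, real_inner_smul_left, norm_mul,
      norm_norm, mul_comm η, mul_assoc] at k1
    have hν : outerNormal E x = unitGradient ψ x := outerNormal_eq h hx
    rw [hν]
    have hn : ‖unitGradient ψ x‖ = 1 := h.norm_unitGradient
    rw [norm_smul, norm_norm, hn, mul_one] at k1
    exact le_of_mul_le_mul_left k1 h.norm_gradient_pos
  strict x hx η hη := by
    obtain ⟨U, ψ, h⟩ := hE x hx
    set B := fderiv ℝ (unitGradient ψ) x with hB
    have hν : outerNormal E x = unitGradient ψ x := outerNormal_eq h hx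
    have h1 := h.hasStrictFDerivAt_unitGradient.isLittleO.def (half_pos hη)
    have h2 := h.hasStrictFDerivAt.isLittleO.def
      (c := ‖gradient ψ x‖ * (η / (2 * (‖B‖ + 1))))
      (mul_pos h.norm_gradient_pos (by positivity))
    rw [nhds_prod_eq] at h1 h2
    obtain ⟨r, hr, hr'⟩ := (Metric.nhds_basis_ball.prod_self.eventually_iff).1
      ((h1.and h2).and (prod_mem_prod (h.isOpen.mem_nhds h.mem) (h.isOpen.mem_nhds h.mem)))
    refine ⟨r, hr, fun y hy z hz => ?_⟩
    obtain ⟨⟨k1, k2⟩, ky, kz⟩ := hr' (x := (y, z)) ⟨hy.2, hz.2⟩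
    dsimp only at k1 k2 ky kz
    have hn : ‖unitGradient ψ x‖ = 1 := h.norm_unitGradient
    rw [(h.of_mem ky).eq_zero hy.1, (h.of_mem kz).eq_zero hz.1, sub_zero, zero_sub, norm_neg,
      ← inner_gradient_left, h.gradient_eq_smul, real_inner_smul_left, norm_mul, norm_norm,
      norm_smul, norm_norm, hn, mul_one, mul_assoc] at k2
    replace k2 := le_of_mul_le_mul_left k2 h.norm_gradient_pos
    rw [h.outerNormal_eqOn ⟨hy.1, ky⟩, h.outerNormal_eqOn ⟨hz.1, kz⟩,
      h.normalGradient_apply hx, map_sub]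
    -- Discarding the normal component of `y - z` costs little, since tangency makes that component
    -- of smaller order.
    have hs : ‖B (inner ℝ (unitGradient ψ x) (y - z) • unitGradient ψ x)‖ ≤
        η / 2 * ‖y - z‖ := by
      refine (B.le_opNorm _).trans ?_
      rw [norm_smul, hn, mul_one]
      calc ‖B‖ * ‖inner ℝ (unitGradient ψ x) (y - z)‖
          ≤ (‖B‖ + 1) * (η / (2 * (‖B‖ + 1)) * ‖y - z‖) := by gcongr; linarith
        _ = η / 2 * ‖y - z‖ := by field_simp
    calc _ = ‖(unitGradient ψ y - unitGradient ψ z - B (y - z)) +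
          B (inner ℝ (unitGradient ψ x) (y - z) • unitGradient ψ x)‖ := by congr 1; abel
      _ ≤ η / 2 * ‖y - z‖ + η / 2 * ‖y - z‖ := (norm_add_le _ _).trans (add_le_add k1 hs)
      _ = _ := by ring
  apply_normal x hx := by
    obtain ⟨U, ψ, h⟩ := hE x hx
    have hν : outerNormal E x = unitGradient ψ x := outerNormal_eq h hx
    rw [h.normalGradient_apply hx, hν, real_inner_self_eq_norm_sq, h.norm_unitGradient]
    simp
  continuousOn := by
    refine continuousOn_clm_apply.2 fun v x hx => ?_
    obtain ⟨U, ψ, h⟩ := hE x hx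
    have hU : U ∈ 𝓝 x := h.isOpen.mem_nhds h.mem
    have hg : ContinuousAt (unitGradient ψ) x :=
      h.contDiffOn_unitGradient.continuousOn.continuousAt hU
    have hf : ContinuousAt (fderiv ℝ (unitGradient ψ)) x :=
      (h.contDiffOn_unitGradient.continuousOn_fderiv_of_isOpen h.isOpen le_rfl).continuousAt hU
    have hi : ContinuousAt (fun y => inner ℝ (unitGradient ψ y) v) x := hg.inner continuousAt_const
    have hc : ContinuousAt (fun y => fderiv ℝ (unitGradient ψ) y
        (v - inner ℝ (unitGradient ψ y) v • unitGradient ψ y)) x :=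
      hf.clm_apply (continuousAt_const.sub (hi.smul hg))
    refine hc.continuousWithinAt.congr_of_eventuallyEq ?_ (h.normalGradient_apply hx v)
    filter_upwards [inter_mem_nhdsWithin _ hU] with y hy
    exact (h.of_mem hy.2).normalGradient_apply hy.1 v

end Geometry

/-! ### Nearest points, touching balls and the sign of the Jacobian -/

section NearestPoints

variable {d : ℕ} {E : Set (EuclideanSpace ℝ (Fin d))} {x y z : EuclideanSpace ℝ (Fin d)}
  {s t : ℝ}

/-- If a ball outside `E` touches the boundary at `x`, its radius to `x` is normal. -/
lemma IsClassC2.eq_add_smul_of_ball (hE : IsClassC2 E) (hx : x ∈ frontier E) (ht : 0 < t)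
    (hz : ‖z - x‖ = t) (hb : ∀ y ∈ Metric.ball z t, y ∉ E) : z = x + t • outerNormal E x := by
  obtain ⟨U, ψ, h⟩ := hE x hx
  have hν : outerNormal E x = unitGradient ψ x := outerNormal_eq h hx
  have hn := h.norm_unitGradient
  rw [hν]
  set e := unitGradient ψ x
  set u := t⁻¹ • (z - x) with hu
  have hun : ‖u‖ = 1 := by
    rw [hu, norm_smul, norm_inv, Real.norm_of_nonneg ht.le, hz, inv_mul_cancel₀ ht.ne']
  have hzu : z = x + t • u := by rw [hu, smul_inv_smul₀ ht.ne']; abel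
  by_contra hne
  have hue : u ≠ e := fun hc => hne (by rw [hzu, hc])
  have hlt : inner ℝ u e < (1 : ℝ) := (inner_lt_one_iff_real_of_norm_eq_one hun hn).2 hue
  -- If the radius direction `u` differs from the normal `e`, a small step from `x` along `u - e`
  -- enters both `E` and the ball.
  have h1 := h.eventually_mem hx (v := u - e) (by
    rw [inner_sub_right, real_inner_self_eq_norm_sq, hn, real_inner_comm]; linarith)
  have hpos : 0 < inner ℝ u (u - e) := by
    rw [inner_sub_right, real_inner_self_eq_norm_sq, hun]; linarith
  have h2 : ∀ᶠ r : ℝ in 𝓝[>] 0, r * ‖u - e‖ ^ 2 < 2 * t * inner ℝ u (u - e) := by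
    have hc : Continuous fun r : ℝ => r * ‖u - e‖ ^ 2 := by fun_prop
    refine ((hc.tendsto 0).mono_left nhdsWithin_le_nhds).eventually (gt_mem_nhds ?_)
    rw [zero_mul]
    positivity
  obtain ⟨r, ⟨hr1, hr2⟩, hr⟩ := ((h1.and h2).and self_mem_nhdsWithin).exists
  replace hr : 0 < r := hr
  refine hb _ ?_ hr1
  rw [Metric.mem_ball, dist_eq_norm, hzu]
  refine lt_of_pow_lt_pow_left₀ 2 ht.le ?_
  have : x + r • (u - e) - (x + t • u) = r • (u - e) - t • u := by abel
  rw [this, norm_sub_sq_real, norm_smul, norm_smul, hun, real_inner_smul_left,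
    real_inner_smul_right, real_inner_comm, mul_pow, mul_pow, Real.norm_eq_abs, Real.norm_eq_abs,
    sq_abs, sq_abs]
  nlinarith

/-- Every point outside `closure E` lies on the normal through a nearest boundary point. -/
lemma IsClassC2.exists_eq_add_smul (hE : IsClassC2 E) (hne : E.Nonempty) (hz : z ∉ closure E) :
    0 < Metric.infDist z E ∧
      ∃ x ∈ frontier E, z = x + Metric.infDist z E • outerNormal E x := by
  have ht : 0 < Metric.infDist z E := by
    rw [← Metric.infDist_closure]
    exact (isClosed_closure.notMem_iff_infDist_pos hne.closure).1 hz
  refine ⟨ht, ?_⟩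
  obtain ⟨x, hx, hd⟩ := isClosed_closure.exists_infDist_eq_dist hne.closure z
  rw [Metric.infDist_closure] at hd
  have hb : ∀ y ∈ Metric.ball z (Metric.infDist z E), y ∉ E := fun y hy hyE =>
    (Metric.infDist_le_dist_of_mem hyE).not_gt (by rwa [dist_comm])
  have hxc : x ∈ closure Eᶜ := by
    have h1 : x ∈ closure (Metric.ball z (Metric.infDist z E)) := by
      rw [closure_ball _ ht.ne', Metric.mem_closedBall, dist_comm, hd]
    exact closure_mono hb h1
  have hxf : x ∈ frontier E := by rw [frontier_eq_closure_inter_closure]; exact ⟨hx, hxc⟩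
  exact ⟨x, hxf, hE.eq_add_smul_of_ball hxf ht (by rw [hd, dist_eq_norm]) hb⟩

/-- Quantitative uniqueness of the nearest boundary point. -/
lemma norm_sq_sub_ge_of_infDist_eq (he : ‖outerNormal E x‖ = 1) (ht : 0 < t) (hs : 0 ≤ s)
    (h : Metric.infDist (x + t • outerNormal E x) E = t) (hy : y ∈ closure E) :
    s ^ 2 + (1 - s / t) * ‖y - x‖ ^ 2 ≤ ‖y - (x + s • outerNormal E x)‖ ^ 2 := by
  have h1 : t ≤ ‖y - (x + t • outerNormal E x)‖ := by
    rw [← dist_eq_norm, dist_comm]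
    calc t = Metric.infDist (x + t • outerNormal E x) (closure E) := by
          rw [Metric.infDist_closure, h]
      _ ≤ _ := Metric.infDist_le_dist_of_mem hy
  have key (r : ℝ) : ‖y - (x + r • outerNormal E x)‖ ^ 2 =
      ‖y - x‖ ^ 2 - 2 * r * inner ℝ (y - x) (outerNormal E x) + r ^ 2 := by
    rw [← sub_sub, norm_sub_sq_real, norm_smul, he, real_inner_smul_right, mul_one,
      Real.norm_eq_abs, sq_abs]
    ring
  have h2 := pow_le_pow_left₀ ht.le h1 2
  rw [key] at h2 ⊢
  -- The ball of radius `t` gives this bound, and rescaling it by `s / t` gives the one for radius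
  -- `s`.
  have h3 : 2 * t * inner ℝ (y - x) (outerNormal E x) ≤ ‖y - x‖ ^ 2 := by linarith
  have h4 : 2 * s * inner ℝ (y - x) (outerNormal E x) ≤ s / t * ‖y - x‖ ^ 2 := by
    calc 2 * s * inner ℝ (y - x) (outerNormal E x)
        = s / t * (2 * t * inner ℝ (y - x) (outerNormal E x)) := by field_simp
      _ ≤ _ := by gcongr
  linarith

lemma infDist_eq_of_le (he : ‖outerNormal E x‖ = 1) (hx : x ∈ frontier E) (ht : 0 < t)
    (hs : 0 ≤ s) (hst : s ≤ t) (h : Metric.infDist (x + t • outerNormal E x) E = t) :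
    Metric.infDist (x + s • outerNormal E x) E = s := by
  have hxc : x ∈ closure E := frontier_subset_closure hx
  rw [← Metric.infDist_closure]
  refine le_antisymm ?_ ?_
  · refine (Metric.infDist_le_dist_of_mem hxc).trans ?_
    rw [dist_eq_norm, add_sub_cancel_left, norm_smul, he, mul_one, Real.norm_of_nonneg hs]
  · refine (Metric.le_infDist ⟨x, hxc⟩).2 fun y hy => ?_
    have := norm_sq_sub_ge_of_infDist_eq he ht hs h hy
    rw [dist_comm, dist_eq_norm]
    refine (pow_le_pow_iff_left₀ hs (norm_nonneg _) two_ne_zero).1 (le_trans ?_ this)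
    have : 0 ≤ 1 - s / t := by rw [sub_nonneg, div_le_one ht]; exact hst
    have := mul_nonneg this (sq_nonneg ‖y - x‖)
    linarith

/-- The distance to the boundary agrees with the distance to the set, outside the set. -/
lemma IsClassC2.infDist_frontier (hE : IsClassC2 E) (hne : E.Nonempty) (hz : z ∉ closure E) :
    Metric.infDist z (frontier E) = Metric.infDist z E := by
  obtain ⟨ht, x, hx, hzx⟩ := hE.exists_eq_add_smul hne hz
  have he := hE.isNormalField.norm_eq_one x hx
  refine le_antisymm ?_ ?_
  · refine (Metric.infDist_le_dist_of_mem hx).trans ?_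
    conv_lhs => rw [hzx]
    rw [dist_eq_norm, add_sub_cancel_left, norm_smul, he, mul_one, Real.norm_of_nonneg ht.le]
  · conv_lhs => rw [← Metric.infDist_closure]
    exact Metric.infDist_le_infDist_of_subset frontier_subset_closure ⟨x, hx⟩

/-- If `k` and `θ` vanish at `0`, the derivative of `k` is negative where `θ` is, and `θ` has
negative derivative at `0`, then `k` is negative to the right of `0`. -/
lemma exists_neg_of_hasDerivAt {k k' θ : ℝ → ℝ} {δ θ' : ℝ} (hδ : 0 < δ) (hk0 : k 0 = 0)
    (hk : ∀ r, |r| < δ → HasDerivAt k (k' r) r) (hsign : ∀ r, |r| < δ → θ r < 0 → k' r < 0)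
    (hθ0 : θ 0 = 0) (hθ : HasDerivAt θ θ' 0) (hθ' : θ' < 0) :
    ∀ᶠ r in 𝓝[>] (0 : ℝ), k r < 0 := by
  have h1 := (hasDerivAt_iff_tendsto_slope.1 hθ).eventually (gt_mem_nhds hθ')
  have h2 : 𝓝[>] (0 : ℝ) ≤ 𝓝[≠] 0 := nhdsWithin_mono _ fun t ht => ne_of_gt ht
  have h3 : ∀ᶠ r in 𝓝[>] (0 : ℝ), θ r < 0 := by
    filter_upwards [h2 h1, self_mem_nhdsWithin] with r hr hr0
    rw [slope_def_field, hθ0, sub_zero, sub_zero] at hr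
    exact (div_neg_iff.1 hr).elim (fun h => absurd hr0 (not_lt.2 h.2.le)) fun h => h.1
  obtain ⟨b, hb, hbs⟩ := (mem_nhdsGT_iff_exists_Ioo_subset).1 h3
  have hmin : 0 < min b δ := lt_min hb hδ
  have habs {r : ℝ} (hr : r ∈ Ico 0 (min b δ)) : |r| < δ := by
    rw [abs_of_nonneg hr.1]; exact hr.2.trans_le (min_le_right _ _)
  have hanti : StrictAntiOn k (Ico 0 (min b δ)) := by
    refine strictAntiOn_of_deriv_neg (convex_Ico _ _)
      (fun r hr => (hk r (habs hr)).continuousAt.continuousWithinAt) fun r hr => ?_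
    rw [interior_Ico] at hr
    have hr' := habs (Ioo_subset_Ico_self hr)
    rw [(hk r hr').deriv]
    exact hsign r hr' (hbs ⟨hr.1, hr.2.trans_le (min_le_left _ _)⟩)
  filter_upwards [Ioo_mem_nhdsGT hmin] with r hr
  rw [← hk0]
  exact hanti ⟨le_rfl, hmin⟩ (Ioo_subset_Ico_self hr) hr.1

/-- A ball of radius `t` touching `E` from outside bounds the curvatures from below by `-1 / t`. -/
lemma IsClassC2.inner_normalGradient_ge (hE : IsClassC2 E) (hx : x ∈ frontier E) (ht : 0 < t)
    (h : Metric.infDist (x + t • outerNormal E x) E = t) {v : EuclideanSpace ℝ (Fin d)}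
    (hv : inner ℝ (outerNormal E x) v = 0) :
    0 ≤ ‖v‖ ^ 2 + t * inner ℝ (normalGradient E x v) v := by
  rcases eq_or_ne v 0 with rfl | hv0
  · simp
  have hvn : 0 < ‖v‖ ^ 2 := by positivity
  obtain ⟨U, ψ, hψ⟩ := hE x hx
  have hν : outerNormal E x = unitGradient ψ x := outerNormal_eq hψ hx
  have hn := hψ.norm_unitGradient
  rw [hψ.normalGradient_apply hx]
  rw [hν] at hv h
  rw [hv, zero_smul, sub_zero]
  set e := unitGradient ψ x with he
  set B := fderiv ℝ (unitGradient ψ) x with hB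
  by_contra hneg
  push Not at hneg
  obtain ⟨a, ha1, ha2⟩ : ∃ a : ℝ, 1 < a ∧ a * ‖v‖ ^ 2 + t * inner ℝ (B v) v < 0 := by
    have hc : Continuous fun a : ℝ => a * ‖v‖ ^ 2 + t * inner ℝ (B v) v := by fun_prop
    have h1 : ∀ᶠ a : ℝ in 𝓝[>] 1, a * ‖v‖ ^ 2 + t * inner ℝ (B v) v < 0 :=
      ((hc.tendsto 1).mono_left nhdsWithin_le_nhds).eventually (gt_mem_nhds (by simpa))
    obtain ⟨a, h2, h3⟩ := (h1.and self_mem_nhdsWithin).exists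
    exact ⟨a, h3, h2⟩
  -- The parabola `x + r v + b r² e` bends more than the sphere because `a > 1`, so it enters the
  -- touching ball for small `r > 0`. It also enters `E`, because `inner ℝ (B v) v + 2 * b < 0`
  -- makes `ψ` decrease along it. This contradicts the distance `t`.
  set b : ℝ := a * ‖v‖ ^ 2 / (2 * t) with hb
  set c : ℝ → EuclideanSpace ℝ (Fin d) := fun r => x + r • v + (b * r ^ 2) • e with hc
  set c' : ℝ → EuclideanSpace ℝ (Fin d) := fun r => v + (2 * b * r) • e with hc'
  have hcd (r : ℝ) : HasDerivAt c (c' r) r := by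
    have h1 : HasDerivAt (fun r : ℝ => x + r • v) v r := by
      simpa using ((hasDerivAt_id r).smul_const v).const_add x
    have h2 : HasDerivAt (fun r : ℝ => b * r ^ 2) (2 * b * r) r := by
      exact ((hasDerivAt_pow 2 r).const_mul b).congr_deriv (by norm_num; ring)
    exact h1.add (h2.smul_const e)
  have hc0 : c 0 = x := by simp [hc]
  have hc'0 : c' 0 = v := by simp [hc']
  have hcc : Continuous c := by rw [hc]; fun_prop
  obtain ⟨δ, hδ, hδU⟩ : ∃ δ > 0, ∀ r, |r| < δ → c r ∈ U := by
    have : c ⁻¹' U ∈ 𝓝 (0 : ℝ) :=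
      hcc.continuousAt (by rw [hc0]; exact hψ.isOpen.mem_nhds hψ.mem)
    obtain ⟨δ, hδ, hs⟩ := Metric.mem_nhds_iff.1 this
    exact ⟨δ, hδ, fun r hr => hs (by simpa using hr)⟩
  have hneg := exists_neg_of_hasDerivAt (k := fun r => ψ (c r))
    (k' := fun r => inner ℝ (gradient ψ (c r)) (c' r))
    (θ := fun r => inner ℝ (unitGradient ψ (c r)) (c' r))
    (θ' := inner ℝ (B v) v + 2 * b) hδ (by simp only [hc0]; exact hψ.eq_zero hx)
    (fun r hr => ?_) (fun r hr hθ => ?_) ?_ ?_ ?_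
  · have hU : ∀ᶠ r in 𝓝[>] (0 : ℝ), |r| < δ :=
      nhdsWithin_le_nhds (continuous_abs.continuousAt.eventually (gt_mem_nhds (by simpa)))
    have hsmall : ∀ᶠ r in 𝓝[>] (0 : ℝ), b ^ 2 * r ^ 2 < (a - 1) * ‖v‖ ^ 2 := by
      have hcont : Continuous fun r : ℝ => b ^ 2 * r ^ 2 := by fun_prop
      refine ((hcont.tendsto 0).mono_left nhdsWithin_le_nhds).eventually (gt_mem_nhds ?_)
      have : 0 < (a - 1) * ‖v‖ ^ 2 := mul_pos (by linarith) hvn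
      simpa using this
    obtain ⟨r, ⟨hr1, hr2, hr3⟩, hr⟩ :=
      ((hneg.and (hU.and hsmall)).and self_mem_nhdsWithin).exists
    replace hr : 0 < r := hr
    have hmem : c r ∈ E := hψ.neg _ (hδU r hr2) hr1
    have hle : t ≤ ‖c r - (x + t • e)‖ := by
      rw [← dist_eq_norm, dist_comm]
      conv_lhs => rw [← h]
      exact Metric.infDist_le_dist_of_mem hmem
    have hle2 := pow_le_pow_left₀ ht.le hle 2
    have heq : c r - (x + t • e) = r • v + (b * r ^ 2 - t) • e := by
      simp only [hc]; module
    rw [heq, norm_add_sq_real, norm_smul, norm_smul, hn, real_inner_smul_left,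
      real_inner_smul_right, real_inner_comm, hv, mul_pow, mul_pow, Real.norm_eq_abs,
      Real.norm_eq_abs, sq_abs, sq_abs] at hle2
    have hbt : 2 * b * t = a * ‖v‖ ^ 2 := by rw [hb]; field_simp
    have hr2' : 0 < r ^ 2 := by positivity
    nlinarith
  · have := ((hψ.of_mem (hδU r hr)).differentiableAt.hasFDerivAt).comp_hasDerivAt r (hcd r)
    rwa [← inner_gradient_left] at this
  · rw [(hψ.of_mem (hδU r hr)).gradient_eq_smul, real_inner_smul_left]
    exact mul_neg_of_pos_of_neg (hψ.of_mem (hδU r hr)).norm_gradient_pos hθ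
  · simp only [hc0, hc'0]
    exact hv
  · have h1 : HasDerivAt (fun r => unitGradient ψ (c r)) (B v) 0 := by
      have h2 : HasFDerivAt (unitGradient ψ) B (c 0) := by
        rw [hc0]; exact hψ.hasStrictFDerivAt_unitGradient.hasFDerivAt
      have := h2.comp_hasDerivAt 0 (hcd 0)
      rw [hc'0] at this
      exact this
    have h3 : HasDerivAt c' ((2 * b) • e) 0 := by
      have : HasDerivAt (fun r : ℝ => 2 * b * r) (2 * b) 0 := by
        simpa using (hasDerivAt_id (0 : ℝ)).const_mul (2 * b)
      exact (this.smul_const e).const_add v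
    refine (h1.inner ℝ h3).congr_deriv ?_
    rw [hc0, hc'0, real_inner_smul_right, ← he, real_inner_self_eq_norm_sq, hn]
    ring
  · have : t * (inner ℝ (B v) v + 2 * b) < 0 := by
      have hbt : 2 * b * t = a * ‖v‖ ^ 2 := by rw [hb]; field_simp
      linarith
    exact (mul_neg_iff.1 this).elim (fun h => h.2) fun h => absurd ht (not_lt.2 h.1.le)

/-- Before the cut time, the Jacobian of the normal map is positive. -/
lemma IsClassC2.normalJac_pos (hE : IsClassC2 E) (hx : x ∈ frontier E) (hs : 0 ≤ s) (hst : s < t)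
    (h : Metric.infDist (x + t • outerNormal E x) E = t) :
    0 < normalJac (normalGradient E) (x, s) := by
  have ht : 0 < t := hs.trans_lt hst
  -- The tangential part `w` of a kernel vector satisfies `‖w‖ ^ 2 + r * inner ℝ (A w) w = 0`, where
  -- `A` is the normal gradient at `x`. The curvature bound at radius `t > r` then forces `w = 0`.
  -- Positivity follows by continuity from the value `1` at `r = 0`.
  have hne (r : ℝ) (hr : r ∈ Icc 0 s) : normalJac (normalGradient E) (x, r) ≠ 0 := by
    intro h0
    obtain ⟨v, hv, hv0⟩ := (Submodule.ne_bot_iff _).1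
      (LinearMap.bot_lt_ker_of_det_eq_zero h0).ne'
    have hv' : v + r • normalGradient E x v = 0 := by simpa using hv
    have he := hE.isNormalField.norm_eq_one x hx
    obtain ⟨U, ψ, hψ⟩ := hE x hx
    have hν : outerNormal E x = unitGradient ψ x := outerNormal_eq hψ hx
    set e := outerNormal E x
    set w := v - inner ℝ e v • e with hw
    have hwe : inner ℝ e w = 0 := by
      rw [hw, inner_sub_right, real_inner_smul_right, real_inner_self_eq_norm_sq, he]; ring
    have hAw : normalGradient E x w = normalGradient E x v := by
      rw [hw, map_sub, map_smul, hE.isNormalField.apply_normal x hx, smul_zero, sub_zero]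
    have h1 := hE.inner_normalGradient_ge hx ht h hwe
    have h2 : ‖w‖ ^ 2 + r * inner ℝ (normalGradient E x w) w = 0 := by
      have := congrArg (fun u => inner ℝ u w) hv'
      simp only [inner_add_left, real_inner_smul_left, inner_zero_left] at this
      rw [hAw, ← this]
      congr 1
      have hvw : v = w + inner ℝ e v • e := by rw [hw]; abel
      conv_rhs => rw [hvw]
      rw [inner_add_left, real_inner_smul_left, hwe, mul_zero, add_zero, real_inner_self_eq_norm_sq]
    have hw0 : w = 0 := by
      have : ‖w‖ ^ 2 * (t - r) ≤ 0 := by nlinarith [hr.1, hr.2, sq_nonneg ‖w‖]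
      have hpos : 0 < t - r := by linarith [hr.2]
      have : ‖w‖ ^ 2 ≤ 0 := by
        by_contra hc
        push Not at hc
        exact absurd (mul_pos hc hpos) (not_lt.2 this)
      exact norm_eq_zero.1 (pow_eq_zero_iff two_ne_zero |>.1 (le_antisymm this (sq_nonneg _)))
    rw [hw0, map_zero] at hAw
    rw [← hAw, smul_zero, add_zero] at hv'
    exact hv0 hv'
  have h0 : normalJac (normalGradient E) (x, 0) = 1 := by
    simp [normalJac, ContinuousLinearMap.det]
  have hc : ContinuousOn (fun r : ℝ => normalJac (normalGradient E) (x, r)) (Icc 0 s) := by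
    refine hE.isNormalField.continuousOn_normalJac.comp (by fun_prop) fun r _ => ?_
    exact ⟨hx, trivial⟩
  by_contra hneg
  push Not at hneg
  obtain ⟨r, hr, hr0⟩ := intermediate_value_Icc' hs hc (show (0 : ℝ) ∈ Icc _ _ from
    ⟨hneg, by rw [h0]; exact zero_le_one⟩)
  exact hne r hr hr0

end NearestPoints

/-! ### Normal coordinates up to the cut point -/

section NormalDomain

set_option linter.unusedSectionVars false

variable {d : ℕ} {E : Set (EuclideanSpace ℝ (Fin d))} {R : ℝ}

/-- The pairs `(y, s)` with `0 < s < R` such that `y + s ν(y)` lies on the normal through `y`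
strictly before the cut point. -/
def normalDomain (R : ℝ) (E : Set (EuclideanSpace ℝ (Fin d))) :
    Set (EuclideanSpace ℝ (Fin d) × ℝ) :=
  {p | p.1 ∈ frontier E ∧ p.2 ∈ Ioo 0 R ∧
    ∃ q : ℚ, p.2 < q ∧ Metric.infDist (p.1 + (q : ℝ) • outerNormal E p.1) E = q}

lemma normalDomain_subset : normalDomain R E ⊆ frontier E ×ˢ univ := fun _ hp => ⟨hp.1, trivial⟩

lemma normalDomain_subset_Ioo : normalDomain R E ⊆ frontier E ×ˢ Ioo 0 R :=
  fun _ hp => ⟨hp.1, hp.2.1⟩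

lemma IsClassC2.mem_normalDomain (hE : IsClassC2 E) {y : EuclideanSpace ℝ (Fin d)} {s t : ℝ}
    (hy : y ∈ frontier E) (hs : s ∈ Ioo 0 R) (hst : s < t)
    (h : Metric.infDist (y + t • outerNormal E y) E = t) : (y, s) ∈ normalDomain R E := by
  obtain ⟨q, hq1, hq2⟩ := exists_rat_btwn hst
  exact ⟨hy, hs, q, hq1, infDist_eq_of_le (hE.isNormalField.norm_eq_one y hy) hy
    (hs.1.trans hst) (hs.1.trans hq1).le hq2.le h⟩

lemma IsClassC2.infDist_of_mem_normalDomain (hE : IsClassC2 E)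
    {p : EuclideanSpace ℝ (Fin d) × ℝ} (hp : p ∈ normalDomain R E) :
    Metric.infDist (normalMap (outerNormal E) p) E = p.2 := by
  obtain ⟨hy, hs, q, hq, h⟩ := hp
  exact infDist_eq_of_le (hE.isNormalField.norm_eq_one _ hy) hy (hs.1.trans hq) hs.1.le hq.le h

lemma notMem_closure_of_infDist_pos {z : EuclideanSpace ℝ (Fin d)} (h : 0 < Metric.infDist z E) :
    z ∉ closure E := fun hz => h.ne' (by
  rw [← Metric.infDist_closure]; exact Metric.infDist_zero_of_mem hz)

lemma IsClassC2.notMem_closure_of_mem_normalDomain (hE : IsClassC2 E)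
    {p : EuclideanSpace ℝ (Fin d) × ℝ} (hp : p ∈ normalDomain R E) :
    normalMap (outerNormal E) p ∉ closure E :=
  notMem_closure_of_infDist_pos (by rw [hE.infDist_of_mem_normalDomain hp]; exact hp.2.1.1)

lemma IsClassC2.isClosed_infDist_eq (hE : IsClassC2 E) (t : ℝ) :
    IsClosed {y | y ∈ frontier E ∧ Metric.infDist (y + t • outerNormal E y) E = t} := by
  have hc : ContinuousOn (fun y => Metric.infDist (y + t • outerNormal E y) E) (frontier E) :=
    (Metric.continuous_infDist_pt E).comp_continuousOn
      (continuousOn_id.add (hE.isNormalField.continuousOn_normal.const_smul t))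
  exact hc.preimage_isClosed_of_isClosed isClosed_frontier (isClosed_singleton (x := t))

/-- Taking the witness beyond `s` rational makes the domain a countable union of products of a
closed set with a half-line. -/
lemma IsClassC2.measurableSet_normalDomain (hE : IsClassC2 E) :
    MeasurableSet (normalDomain R E) := by
  have : normalDomain R E = (univ ×ˢ Ioo 0 R) ∩
      ⋃ q : ℚ, {y | y ∈ frontier E ∧ Metric.infDist (y + (q : ℝ) • outerNormal E y) E = q} ×ˢ
        Iio (q : ℝ) := by
    ext p
    simp only [normalDomain, mem_ofPred_eq, mem_inter_iff, mem_prod, mem_univ, true_and,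
      mem_iUnion, mem_Iio]
    constructor
    · rintro ⟨h1, h2, q, h3, h4⟩
      exact ⟨h2, q, ⟨h1, h4⟩, h3⟩
    · rintro ⟨h2, q, ⟨h1, h4⟩, h3⟩
      exact ⟨h1, h2, q, h3, h4⟩
  rw [this]
  exact (MeasurableSet.univ.prod measurableSet_Ioo).inter (MeasurableSet.iUnion fun q =>
    (hE.isClosed_infDist_eq q).measurableSet.prod measurableSet_Iio)

/-- The height is recovered as the distance to `E`. The foot is then the unique nearest point,
because the height lies strictly below a value `t` at which the distance is still full, so the
factor `1 - s / t` is positive. -/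
lemma IsClassC2.injOn_normalDomain (hE : IsClassC2 E) :
    InjOn (normalMap (outerNormal E)) (normalDomain R E) := by
  intro p hp q hq hpq
  have h2 : p.2 = q.2 := by
    rw [← hE.infDist_of_mem_normalDomain hp, hpq, hE.infDist_of_mem_normalDomain hq]
  refine Prod.ext ?_ h2
  obtain ⟨hy, hs, t, ht, h⟩ := hp
  have ht0 : (0 : ℝ) < t := hs.1.trans ht
  have h3 := norm_sq_sub_ge_of_infDist_eq (hE.isNormalField.norm_eq_one _ hy) ht0 hs.1.le h
    (frontier_subset_closure hq.1)
  have h4 : ‖q.1 - (p.1 + p.2 • outerNormal E p.1)‖ = p.2 := by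
    change ‖q.1 - normalMap (outerNormal E) p‖ = p.2
    rw [hpq, normalMap, sub_add_cancel_left, norm_neg, norm_smul,
      hE.isNormalField.norm_eq_one _ hq.1, mul_one, Real.norm_of_nonneg hq.2.1.1.le, h2]
  rw [h4] at h3
  have h5 : 0 < 1 - p.2 / t := by rw [sub_pos, div_lt_one ht0]; exact ht
  have h6 : ‖q.1 - p.1‖ ^ 2 ≤ 0 := by
    by_contra hc
    push Not at hc
    linarith [mul_pos h5 hc]
  have := norm_eq_zero.1 (pow_eq_zero_iff two_ne_zero |>.1 (le_antisymm h6 (sq_nonneg _)))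
  exact (sub_eq_zero.1 this).symm

/-- A unit normal exists, so a nonempty boundary excludes dimension zero. -/
lemma IsClassC2.nontrivial (hE : IsClassC2 E) (hne : (frontier E).Nonempty) :
    Nontrivial (EuclideanSpace ℝ (Fin d)) := by
  obtain ⟨x, hx⟩ := hne
  refine ⟨outerNormal E x, 0, fun h => ?_⟩
  have := hE.isNormalField.norm_eq_one x hx
  rw [h, norm_zero] at this
  exact zero_ne_one this

variable [Nontrivial (EuclideanSpace ℝ (Fin d))]

lemma IsClassC2.normalMeasure_lt_top (hE : IsClassC2 E) (hS : IsCompact (frontier E))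
    {Z : Set (EuclideanSpace ℝ (Fin d) × ℝ)} (hZ : Z ⊆ frontier E ×ˢ Ioo 0 R) :
    normalMeasure (frontier E) Z < ∞ := by
  have hfin := hE.isNormalField.measure_lt_top hS
  have : Fact ((μHE[finrank ℝ (EuclideanSpace ℝ (Fin d)) - 1] :
    Measure (EuclideanSpace ℝ (Fin d))) (frontier E) < ∞) := ⟨hfin⟩
  refine (measure_mono hZ).trans_lt ?_
  rw [normalMeasure, Measure.prod_prod]
  exact ENNReal.mul_lt_top (measure_lt_top _ _) (by simp)

/-- Almost every point outside `closure E` lies on a normal before the cut point. -/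
lemma IsClassC2.volume_diff_image_normalDomain (hE : IsClassC2 E) (hS : IsCompact (frontier E))
    (hne : E.Nonempty) :
    volume (((closure E)ᶜ ∩ {z | Metric.infDist z E < R}) \
      normalMap (outerNormal E) '' normalDomain R E) = 0 := by
  have hfin := hE.isNormalField.measure_lt_top hS
  have : Fact ((μHE[finrank ℝ (EuclideanSpace ℝ (Fin d)) - 1] :
    Measure (EuclideanSpace ℝ (Fin d))) (frontier E) < ∞) := ⟨hfin⟩
  set K : Set (EuclideanSpace ℝ (Fin d) × ℝ) :=
    (frontier E ×ˢ Ioo 0 R ∩ {p | p ∈ frontier E ×ˢ univ ∧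
      Metric.infDist (normalMap (outerNormal E) p) E - p.2 = 0}) \ normalDomain R E with hK
  have hKS : K ⊆ frontier E ×ˢ Ioo 0 R := fun p hp => hp.1.1
  have hKm : MeasurableSet K := by
    refine ((isClosed_frontier.measurableSet.prod measurableSet_Ioo).inter ?_).diff
      hE.measurableSet_normalDomain
    have hc : ContinuousOn (fun p : EuclideanSpace ℝ (Fin d) × ℝ =>
        Metric.infDist (normalMap (outerNormal E) p) E - p.2) (frontier E ×ˢ univ) :=
      ((Metric.continuous_infDist_pt E).comp_continuousOn
        hE.isNormalField.continuousOn_normalMap).sub continuousOn_snd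
    exact (hc.preimage_isClosed_of_isClosed (isClosed_frontier.prod isClosed_univ)
      (isClosed_singleton (x := (0 : ℝ)))).measurableSet
  -- Each normal contains at most one height in `K`: of two such heights, the smaller would lie
  -- strictly before the cut point and hence in `normalDomain`. The image of `K` is then null by the
  -- half of the area formula that needs no injectivity.
  have hK0 : normalMeasure (frontier E) K = 0 := by
    rw [normalMeasure, Measure.measure_prod_null hKm]
    refine Eventually.of_forall fun y => Set.Subsingleton.measure_zero ?_ _
    have key {s t : ℝ} (hs : (y, s) ∈ K) (ht : (y, t) ∈ K) : ¬ s < t := fun hst =>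
      hs.2 (hE.mem_normalDomain hs.1.1.1 hs.1.1.2 hst (sub_eq_zero.1 ht.1.2.2))
    exact fun s hs t ht => le_antisymm (not_lt.1 (key ht hs)) (not_lt.1 (key hs ht))
  have h0 : volume (normalMap (outerNormal E) '' K) = 0 := by
    have := hE.isNormalField.volume_image_le hS (hKS.trans (prod_mono subset_rfl (subset_univ _)))
      hKm (by rw [hK0]; simp)
    rw [Measure.restrict_eq_zero.2 hK0, lintegral_zero_measure] at this
    exact le_antisymm this zero_le
  refine measure_mono_null ?_ h0
  rintro z ⟨⟨hz, hzR⟩, hzΩ⟩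
  obtain ⟨ht, x, hx, hzx⟩ := hE.exists_eq_add_smul hne hz
  have hzp : normalMap (outerNormal E) (x, Metric.infDist z E) = z := hzx.symm
  refine ⟨(x, Metric.infDist z E), ⟨⟨⟨hx, ht, hzR⟩, ⟨hx, trivial⟩, ?_⟩, fun hΩ => hzΩ ⟨_, hΩ, hzp⟩⟩,
    hzp⟩
  simp only [hzp, sub_self]

/-- The part of the normal through `y`, up to the cut point, that lies in `D`. -/
def normalSlice (R : ℝ) (E D : Set (EuclideanSpace ℝ (Fin d))) (y : EuclideanSpace ℝ (Fin d)) :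
    Set ℝ :=
  {s | (y, s) ∈ normalDomain R E ∧ y + s • outerNormal E y ∈ D}

lemma IsClassC2.measurableSet_inter_preimage (hE : IsClassC2 E)
    {D : Set (EuclideanSpace ℝ (Fin d))} (hD : IsOpen D) :
    MeasurableSet (normalDomain R E ∩ normalMap (outerNormal E) ⁻¹' D) := by
  obtain ⟨u, hu, hu'⟩ := continuousOn_iff'.1 hE.isNormalField.continuousOn_normalMap D hD
  have : normalDomain R E ∩ normalMap (outerNormal E) ⁻¹' D = normalDomain R E ∩ u := by
    ext p
    have := Set.ext_iff.1 hu' p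
    constructor
    · rintro ⟨h1, h2⟩
      exact ⟨h1, (this.1 ⟨h2, normalDomain_subset h1⟩).1⟩
    · rintro ⟨h1, h2⟩
      exact ⟨h1, (this.2 ⟨h2, normalDomain_subset h1⟩).1⟩
  rw [this]
  exact hE.measurableSet_normalDomain.inter hu.measurableSet

lemma IsClassC2.measurableSet_normalSlice (hE : IsClassC2 E)
    {D : Set (EuclideanSpace ℝ (Fin d))} (hD : IsOpen D) (y : EuclideanSpace ℝ (Fin d)) :
    MeasurableSet (normalSlice R E D y) :=
  measurable_prodMk_left (x := y) (hE.measurableSet_inter_preimage hD)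

lemma IsClassC2.exists_normalJac_le (hE : IsClassC2 E) (hS : IsCompact (frontier E)) (R : ℝ) :
    ∃ M : ℝ, 0 ≤ M ∧
      ∀ p ∈ frontier E ×ˢ Icc 0 R, |normalJac (normalGradient E) p| ≤ M := by
  obtain ⟨M, hM⟩ := (hS.prod (isCompact_Icc (a := 0) (b := R))).exists_bound_of_continuousOn
    (hE.isNormalField.continuousOn_normalJac.mono (prod_mono subset_rfl (subset_univ _)))
  exact ⟨max M 0, le_max_right _ _, fun p hp => (hM p hp).trans (le_max_left _ _)⟩

/-- Volumes outside `closure E` in normal coordinates. -/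
theorem IsClassC2.volume_toReal_eq_integral (hE : IsClassC2 E) (hS : IsCompact (frontier E))
    (hne : E.Nonempty) {D : Set (EuclideanSpace ℝ (Fin d))} (hD : IsOpen D)
    (hDR : ∀ z ∈ D, z ∉ closure E → Metric.infDist z E < R) :
    volume ((closure E)ᶜ ∩ D) ≠ ∞ ∧
    Integrable (fun y => ∫ s in normalSlice R E D y, |normalJac (normalGradient E) (y, s)|)
      ((μHE[d - 1] : Measure (EuclideanSpace ℝ (Fin d))).restrict (frontier E)) ∧
    (volume ((closure E)ᶜ ∩ D)).toReal =
      ∫ y in frontier E, (∫ s in normalSlice R E D y, |normalJac (normalGradient E) (y, s)|)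
        ∂μHE[d - 1] := by
  have hd : finrank ℝ (EuclideanSpace ℝ (Fin d)) = d := by simp
  have hfin := hE.isNormalField.measure_lt_top hS
  have : Fact ((μHE[finrank ℝ (EuclideanSpace ℝ (Fin d)) - 1] :
    Measure (EuclideanSpace ℝ (Fin d))) (frontier E) < ∞) := ⟨hfin⟩
  set Z := normalDomain R E ∩ normalMap (outerNormal E) ⁻¹' D with hZ
  have hZm : MeasurableSet Z := hE.measurableSet_inter_preimage hD
  have hZS : Z ⊆ frontier E ×ˢ Ioo 0 R := inter_subset_left.trans normalDomain_subset_Ioo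
  have hZS' : Z ⊆ frontier E ×ˢ univ := hZS.trans (prod_mono subset_rfl (subset_univ _))
  have hZfin := hE.normalMeasure_lt_top hS hZS
  have hvol : volume ((closure E)ᶜ ∩ D) =
      ∫⁻ q in Z, ENNReal.ofReal |normalJac (normalGradient E) q| ∂normalMeasure (frontier E) := by
    rw [← hE.isNormalField.volume_image_eq hS hZS' hZm hZfin.ne
      (hE.injOn_normalDomain.mono inter_subset_left)]
    refine measure_eq_measure_of_null_sdiff ?_ ?_ |>.symm
    · rintro _ ⟨p, hp, rfl⟩
      exact ⟨hE.notMem_closure_of_mem_normalDomain hp.1, hp.2⟩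
    · refine measure_mono_null ?_ (hE.volume_diff_image_normalDomain (R := R) hS hne)
      rintro z ⟨⟨hz1, hz2⟩, hz3⟩
      refine ⟨⟨hz1, hDR z hz2 hz1⟩, ?_⟩
      rintro ⟨p, hp, rfl⟩
      exact hz3 ⟨p, ⟨hp, hz2⟩, rfl⟩
  obtain ⟨M, hM0, hM⟩ := hE.exists_normalJac_le hS R
  -- Compactness of the boundary and the cutoff `R` bound the Jacobian on a set of finite measure,
  -- so Fubini applies.
  have hint : IntegrableOn (fun q => |normalJac (normalGradient E) q|) Z
      (normalMeasure (frontier E)) := by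
    refine ⟨((hE.isNormalField.continuousOn_normalJac.mono hZS').abs.aestronglyMeasurable hZm),
      HasFiniteIntegral.restrict_of_bounded M hZfin ?_⟩
    filter_upwards [ae_restrict_mem hZm] with q hq
    rw [Real.norm_eq_abs, abs_abs]
    exact hM q ⟨(hZS hq).1, Ioo_subset_Icc_self (hZS hq).2⟩
  have hind := hint.integrable_indicator hZm
  have hslice (y : EuclideanSpace ℝ (Fin d)) :
      ∫ s, Z.indicator (fun q => |normalJac (normalGradient E) q|) (y, s) =
        ∫ s in normalSlice R E D y, |normalJac (normalGradient E) (y, s)| := by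
    rw [← integral_indicator (hE.measurableSet_normalSlice hD y)]
    rfl
  have hof := ofReal_integral_eq_lintegral_ofReal hint
    (Eventually.of_forall fun q => abs_nonneg _)
  refine ⟨by rw [hvol, ← hof]; exact ENNReal.ofReal_ne_top, ?_, ?_⟩
  · have := hind.integral_prod_left
    simp only [hslice, hd] at this
    exact this
  · rw [hvol, ← hof, ENNReal.toReal_ofReal (integral_nonneg fun q => abs_nonneg _),
      ← integral_indicator hZm, normalMeasure, integral_prod _ hind]
    simp only [hslice, hd]

end NormalDomain

/-! ### The displaced boundary along each normal -/

section NormalShift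

set_option linter.unusedSectionVars false

variable {d : ℕ} {E : Set (EuclideanSpace ℝ (Fin d))} {φ : EuclideanSpace ℝ (Fin d) → ℝ}
  {ρ R C ε : ℝ} {y z : EuclideanSpace ℝ (Fin d)}

/-- The normal displacement of the boundary with speed `φ`. -/
def normalShift (E : Set (EuclideanSpace ℝ (Fin d))) (φ : EuclideanSpace ℝ (Fin d) → ℝ) (ε : ℝ)
    (x : EuclideanSpace ℝ (Fin d)) : EuclideanSpace ℝ (Fin d) := x + (ε * φ x) • outerNormal E x

/-- The open `ρ`-neighbourhood of the displaced boundary. -/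
def shiftTube (ρ : ℝ) (E : Set (EuclideanSpace ℝ (Fin d))) (φ : EuclideanSpace ℝ (Fin d) → ℝ)
    (ε : ℝ) : Set (EuclideanSpace ℝ (Fin d)) :=
  {z | Metric.infDist z (normalShift E φ ε '' frontier E) < ρ}

lemma isOpen_shiftTube : IsOpen (shiftTube ρ E φ ε) :=
  isOpen_lt (Metric.continuous_infDist_pt _) continuous_const

lemma normalShift_zero : normalShift E φ 0 '' frontier E = frontier E := by
  have : normalShift E φ 0 = id := by ext1 x; simp [normalShift]
  rw [this, image_id]

lemma IsClassC2.infDist_normalShift_le (hE : IsClassC2 E) (hy : y ∈ frontier E) (t : ℝ) :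
    Metric.infDist (y + t • outerNormal E y) (normalShift E φ ε '' frontier E) ≤
      |t - ε * φ y| := by
  refine (Metric.infDist_le_dist_of_mem (mem_image_of_mem _ hy)).trans ?_
  rw [dist_eq_norm, normalShift, add_sub_add_left_eq_sub, ← sub_smul, norm_smul,
    hE.isNormalField.norm_eq_one y hy, mul_one, Real.norm_eq_abs]

lemma IsClassC2.dist_normalShift_le (hE : IsClassC2 E) (hC : ∀ x ∈ frontier E, |φ x| ≤ C)
    (hy : y ∈ frontier E) : dist y (normalShift E φ ε y) ≤ C * |ε| := by
  rw [dist_comm, dist_eq_norm, normalShift, add_sub_cancel_left, norm_smul,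
    hE.isNormalField.norm_eq_one y hy, mul_one, Real.norm_eq_abs, abs_mul, mul_comm]
  gcongr
  exact hC y hy

lemma IsClassC2.abs_infDist_normalShift_sub_le (hE : IsClassC2 E)
    (hne : (frontier E).Nonempty) (hC : ∀ x ∈ frontier E, |φ x| ≤ C)
    (z : EuclideanSpace ℝ (Fin d)) :
    |Metric.infDist z (normalShift E φ ε '' frontier E) - Metric.infDist z (frontier E)| ≤
      C * |ε| := by
  rw [abs_sub_le_iff]
  constructor
  · rw [sub_le_comm]
    refine (Metric.le_infDist hne).2 fun y hy => ?_
    have h1 := Metric.infDist_le_dist_of_mem (x := z) (mem_image_of_mem (normalShift E φ ε) hy)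
    have h2 := hE.dist_normalShift_le (ε := ε) hC hy
    have h3 := dist_triangle z y (normalShift E φ ε y)
    linarith
  · rw [sub_le_comm]
    refine (Metric.le_infDist (hne.image _)).2 ?_
    rintro _ ⟨y, hy, rfl⟩
    have h1 := Metric.infDist_le_dist_of_mem (x := z) hy
    have h2 := hE.dist_normalShift_le (ε := ε) hC hy
    have h3 := dist_triangle_right z y (normalShift E φ ε y)
    linarith

/-- First order lower bound for the distance to the displaced boundary along a normal, near a
point before the cut point. -/
lemma IsClassC2.exists_infDist_normalShift_ge (hE : IsClassC2 E)
    (hφ : ContinuousOn φ (frontier E)) (hC : ∀ x ∈ frontier E, |φ x| ≤ C) (hρ : 0 < ρ)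
    (hy : y ∈ frontier E) {T : ℝ} (hT : ρ < T)
    (h : Metric.infDist (y + T • outerNormal E y) E = T) {η : ℝ} (hη : 0 < η) :
    ∃ δ > 0, ∀ ε t : ℝ, |ε| < δ → |t - ρ| < δ → t - ε * φ y - η * |ε| ≤
      Metric.infDist (y + t • outerNormal E y) (normalShift E φ ε '' frontier E) := by
  have hC0 : 0 ≤ C := (abs_nonneg _).trans (hC y hy)
  have hT0 : 0 < T := hρ.trans hT
  have hn := hE.isNormalField.norm_eq_one
  have he := hn y hy
  set e := outerNormal E y with hedef
  -- Half of `η` pays for the variation of `φ` near `y`. The other half is `(C + 1) * (2 * κ)`,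
  -- paying for the deviation of the directions `u` and `e'` from `e`.
  set κ := η / (4 * (C + 1)) with hκ
  have hκ0 : 0 < κ := by positivity
  obtain ⟨r, hr, hr1, hr2, hr3⟩ : ∃ r > 0, (∀ x ∈ frontier E, ‖x - y‖ < r → |φ x - φ y| ≤ η / 2) ∧
      (∀ x ∈ frontier E, ‖x - y‖ < r → ‖outerNormal E x - e‖ ≤ κ) ∧ 4 * r / ρ ≤ κ := by
    obtain ⟨r1, h1, h1'⟩ := Metric.continuousWithinAt_iff.1 (hφ y hy) (η / 2) (by positivity)
    obtain ⟨r2, h2, h2'⟩ := Metric.continuousWithinAt_iff.1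
      (hE.isNormalField.continuousOn_normal y hy) κ hκ0
    refine ⟨min (min r1 r2) (κ * ρ / 4), by positivity, fun x hx hxy => ?_, fun x hx hxy => ?_, ?_⟩
    · rw [← Real.dist_eq]
      exact (h1' hx (by
        rw [dist_eq_norm]; exact hxy.trans_le ((min_le_left _ _).trans (min_le_left _ _)))).le
    · rw [← dist_eq_norm]
      exact (h2' hx (by
        rw [dist_eq_norm]; exact hxy.trans_le ((min_le_left _ _).trans (min_le_right _ _)))).le
    · rw [div_le_iff₀ hρ]
      linarith [min_le_right (min r1 r2) (κ * ρ / 4)]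
  set c0 := (T - ρ) / (2 * T) with hc0
  have hc00 : 0 < c0 := div_pos (by linarith) (by positivity)
  -- The margin by which feet at distance at least `r` from `y` are too far away: for `t ≤ T`, `(t +
  -- c1) ^ 2 ≤ t ^ 2 + c1 * (2 * T + 1) ≤ t ^ 2 + c0 * r ^ 2`.
  set c1 := min 1 (c0 * r ^ 2 / (2 * T + 1)) with hc1
  have hc10 : 0 < c1 := by positivity
  have hc1' : c1 * (2 * T + 1) ≤ c0 * r ^ 2 := by
    rw [← le_div_iff₀ (by positivity)]; exact min_le_right _ _
  set δ := min (min (ρ / 2) ((T - ρ) / 2)) (c1 / (2 * (C + 1))) with hδ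
  have hTρ : 0 < (T - ρ) / 2 := by linarith
  have hδ0 : 0 < δ := by positivity
  refine ⟨δ, hδ0, fun ε t hε ht => (Metric.le_infDist ⟨_, mem_image_of_mem _ hy⟩).2 ?_⟩
  have hδ1 : δ ≤ ρ / 2 := (min_le_left _ _).trans (min_le_left _ _)
  have hδ2 : δ ≤ (T - ρ) / 2 := (min_le_left _ _).trans (min_le_right _ _)
  have hδ3 : δ ≤ c1 / (2 * (C + 1)) := min_le_right _ _
  obtain ⟨ht1, ht2⟩ := abs_lt.1 ht
  have ht0 : ρ / 2 ≤ t := by linarith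
  have htT : t ≤ (ρ + T) / 2 := by linarith
  have htpos : 0 < t := by linarith
  rintro _ ⟨x, hx, rfl⟩
  rw [dist_eq_norm]
  set e' := outerNormal E x with he'
  have hne' : ‖e'‖ = 1 := hn x hx
  set a := y + t • e - x with ha
  have hza : y + t • e - normalShift E φ ε x = a - (ε * φ x) • e' := by
    simp only [normalShift, ha, he']; abel
  rw [hza]
  have hq := norm_sq_sub_ge_of_infDist_eq he hT0 htpos.le h (frontier_subset_closure hx)
  have hax : ‖x - (y + t • e)‖ = ‖a‖ := by rw [norm_sub_rev]
  rw [hax] at hq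
  have hcoef : c0 ≤ 1 - t / T := by
    rw [hc0, le_sub_iff_add_le, div_add_div _ _ (by positivity) hT0.ne', div_le_one (by positivity)]
    nlinarith
  have hcε : |ε * φ x| ≤ C * |ε| := by
    rw [abs_mul, mul_comm]; gcongr; exact hC x hx
  have hcε' : |ε * φ y| ≤ C * |ε| := by
    rw [abs_mul, mul_comm]; gcongr; exact hC y hy
  -- For feet near `y`, projecting on the direction `u` of `a` gives the first order bound. For
  -- distant feet, the margin `c1` exceeds the two displacements, each at most `C * |ε|`.
  rcases lt_or_ge ‖x - y‖ r with hxr | hxr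
  · have hat : t ≤ ‖a‖ := by
      refine (pow_le_pow_iff_left₀ htpos.le (norm_nonneg _) two_ne_zero).1 (le_trans ?_ hq)
      have := mul_nonneg (hc00.le.trans hcoef) (sq_nonneg ‖x - y‖)
      linarith
    have ha0 : 0 < ‖a‖ := htpos.trans_le hat
    set u := ‖a‖⁻¹ • a with hu
    have hun : ‖u‖ = 1 := by rw [hu, norm_smul, norm_inv, norm_norm, inv_mul_cancel₀ ha0.ne']
    have hau : a = ‖a‖ • u := by rw [hu, smul_inv_smul₀ ha0.ne']
    have hue : ‖u - e‖ ≤ κ := by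
      refine le_trans ?_ hr3
      rw [le_div_iff₀ hρ]
      have h1 : ‖a‖ • (u - e) = (y - x) + (t - ‖a‖) • e := by
        rw [smul_sub, ← hau, ha]; module
      have h2 : |t - ‖a‖| ≤ ‖y - x‖ := by
        have h3 : |‖t • e‖ - ‖a‖| ≤ ‖t • e - a‖ := abs_norm_sub_norm_le _ _
        rw [norm_smul, he, mul_one, Real.norm_of_nonneg htpos.le] at h3
        have h4 : t • e - a = -(y - x) := by rw [ha]; abel
        rwa [h4, norm_neg] at h3
      have h5 : ‖a‖ * ‖u - e‖ ≤ 2 * ‖y - x‖ := by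
        calc ‖a‖ * ‖u - e‖ = ‖‖a‖ • (u - e)‖ := by rw [norm_smul, norm_norm]
          _ ≤ ‖y - x‖ + |t - ‖a‖| := by
            rw [h1]
            refine (norm_add_le _ _).trans_eq ?_
            rw [norm_smul, he, mul_one, Real.norm_eq_abs]
          _ ≤ _ := by linarith
      have h6 : ρ / 2 * ‖u - e‖ ≤ ‖a‖ * ‖u - e‖ := by gcongr; linarith
      rw [norm_sub_rev] at hxr
      linarith
    have hinner : |inner ℝ u e' - 1| ≤ 2 * κ := by
      have h1 : inner ℝ u e' - 1 = inner ℝ (u - e') e' := by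
        rw [inner_sub_left, real_inner_self_eq_norm_sq, hne']; ring
      rw [h1]
      refine (abs_real_inner_le_norm _ _).trans ?_
      rw [hne', mul_one]
      have h2 : u - e' = (u - e) - (e' - e) := by abel
      rw [h2]
      exact (norm_sub_le _ _).trans (by linarith [hr2 x hx hxr])
    have hlow : ‖a‖ - ε * φ x * inner ℝ u e' ≤ ‖a - (ε * φ x) • e'‖ := by
      have h1 := real_inner_le_norm u (a - (ε * φ x) • e')
      rw [hun, one_mul, inner_sub_right, real_inner_smul_right] at h1
      have h2 : inner ℝ u a = ‖a‖ := by
        conv_lhs => rw [hau]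
        rw [real_inner_smul_right, real_inner_self_eq_norm_sq, hun]; ring
      rwa [h2] at h1
    have hdiff : |φ x * inner ℝ u e' - φ y| ≤ η := by
      have h1 : φ x * inner ℝ u e' - φ y = (φ x - φ y) + φ x * (inner ℝ u e' - 1) := by ring
      rw [h1]
      refine (abs_add_le _ _).trans ?_
      rw [abs_mul]
      have h2 : |φ x| * |inner ℝ u e' - 1| ≤ (C + 1) * (2 * κ) := by
        gcongr
        exact (hC x hx).trans (by linarith)
      have h3 : (C + 1) * (2 * κ) = η / 2 := by rw [hκ]; field_simp; ring
      linarith [hr1 x hx hxr]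
    have hfin : ε * (φ x * inner ℝ u e' - φ y) ≤ η * |ε| := by
      refine (le_abs_self _).trans ?_
      rw [abs_mul, mul_comm]
      gcongr
    linarith
  · have hac : t + c1 ≤ ‖a‖ := by
      refine (pow_le_pow_iff_left₀ (by positivity) (norm_nonneg _) two_ne_zero).1 (le_trans ?_ hq)
      have h1 : c0 * r ^ 2 ≤ (1 - t / T) * ‖x - y‖ ^ 2 :=
        mul_le_mul hcoef (pow_le_pow_left₀ hr.le hxr 2) (sq_nonneg _) (hc00.le.trans hcoef)
      have h2 : c1 * c1 ≤ c1 * 1 := mul_le_mul_of_nonneg_left (min_le_left _ _) hc10.le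
      have h3 : c1 * t ≤ c1 * T := mul_le_mul_of_nonneg_left (by linarith) hc10.le
      linarith [show (t + c1) ^ 2 = t ^ 2 + 2 * (c1 * t) + c1 * c1 by ring]
    have hsm : 2 * (C + 1) * |ε| ≤ c1 := by
      have := (hε.le.trans hδ3)
      rw [le_div_iff₀ (by positivity)] at this
      linarith
    have h1 : ‖a‖ - C * |ε| ≤ ‖a - (ε * φ x) • e'‖ := by
      have := norm_sub_norm_le a ((ε * φ x) • e')
      rw [norm_smul, hne', mul_one, Real.norm_eq_abs] at this
      linarith
    have h2 := (abs_le.1 hcε').1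
    have h3 := mul_nonneg hη.le (abs_nonneg ε)
    have h4 := abs_nonneg ε
    linarith

lemma abs_setIntegral_sub_le {A B : Set ℝ} (hA : MeasurableSet A) (hB : MeasurableSet B)
    (hAR : A ⊆ Icc 0 R) (hBR : B ⊆ Icc 0 R) {j : ℝ → ℝ} (hj : Continuous j) {M : ℝ} (hM0 : 0 ≤ M)
    (hM : ∀ s ∈ Icc 0 R, |j s| ≤ M) {a b : ℝ} (hab : a ≤ b) (h1 : A \ B ⊆ Icc a b)
    (h2 : B \ A ⊆ Icc a b) : |(∫ s in A, j s) - ∫ s in B, j s| ≤ M * (b - a) := by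
  have hi : IntegrableOn j (Icc 0 R) := hj.continuousOn.integrableOn_compact isCompact_Icc
  have hiA := (hi.mono_set hAR).integrable_indicator hA
  have hiB := (hi.mono_set hBR).integrable_indicator hB
  rw [← integral_indicator hA, ← integral_indicator hB, ← integral_sub hiA hiB, ← Real.norm_eq_abs]
  have hg : Integrable ((Icc a b).indicator fun _ => M) :=
    (integrableOn_const (by simp)).integrable_indicator measurableSet_Icc
  refine (norm_integral_le_of_norm_le hg (Eventually.of_forall fun s => ?_)).trans_eq ?_
  · have hind : 0 ≤ (Icc a b).indicator (fun _ => M) s := indicator_nonneg (fun _ _ => hM0) s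
    by_cases hsA : s ∈ A <;> by_cases hsB : s ∈ B
    · simpa [hsA, hsB] using hind
    · simpa [hsA, hsB, h1 ⟨hsA, hsB⟩] using hM s (hAR hsA)
    · simpa [hsA, hsB, h2 ⟨hsB, hsA⟩] using hM s (hBR hsB)
    · simpa [hsA, hsB] using hind
  · rw [integral_indicator measurableSet_Icc, setIntegral_const]
    simp [hab, mul_comm]

lemma continuous_normalJac (A : EuclideanSpace ℝ (Fin d) →
    EuclideanSpace ℝ (Fin d) →L[ℝ] EuclideanSpace ℝ (Fin d)) (y : EuclideanSpace ℝ (Fin d)) :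
    Continuous fun s : ℝ => normalJac A (y, s) :=
  ContinuousLinearMap.continuous_det.comp
    (continuous_const.add (continuous_id.smul (continuous_const (y := A y))))

lemma normalSlice_subset (D : Set (EuclideanSpace ℝ (Fin d))) :
    normalSlice R E D y ⊆ Icc 0 R := fun _ hs => Ioo_subset_Icc_self hs.1.2.1

/-- On normals before the cut point, only points at distance about `ρ` enter or leave the tube. -/
lemma IsClassC2.abs_sub_le_of_mem_diff (hE : IsClassC2 E) (hne : (frontier E).Nonempty)
    (hC : ∀ x ∈ frontier E, |φ x| ≤ C) {s : ℝ} (hs : (y, s) ∈ normalDomain R E)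
    (h : ¬ (y + s • outerNormal E y ∈ shiftTube ρ E φ ε ↔
      y + s • outerNormal E y ∈ shiftTube ρ E φ 0)) : |s - ρ| ≤ C * |ε| := by
  have hEne : E.Nonempty := by
    rw [nonempty_iff_ne_empty]; rintro rfl; simp at hne
  have h1 := hE.abs_infDist_normalShift_sub_le (ε := ε) hne hC (y + s • outerNormal E y)
  have h2 : Metric.infDist (y + s • outerNormal E y) (frontier E) = s :=
    (hE.infDist_frontier hEne (hE.notMem_closure_of_mem_normalDomain hs)).trans
      (hE.infDist_of_mem_normalDomain hs)
  simp only [shiftTube, mem_ofPred_eq, normalShift_zero, h2] at h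
  rw [h2] at h1
  obtain ⟨h3, h4⟩ := abs_le.1 h1
  rw [abs_le]
  by_cases hs' : s < ρ
  · have : ρ ≤ Metric.infDist (y + s • outerNormal E y) (normalShift E φ ε '' frontier E) :=
      not_lt.1 fun hlt => h ⟨fun _ => hs', fun _ => hlt⟩
    constructor <;> linarith
  · have : Metric.infDist (y + s • outerNormal E y) (normalShift E φ ε '' frontier E) < ρ := by
      by_contra hlt
      exact h ⟨fun h => absurd h hlt, fun h => absurd h hs'⟩
    constructor <;> linarith

/-- The volume of the part of the tube in the direction of the normal at `y`. -/
def normalContent (ρ : ℝ) (E : Set (EuclideanSpace ℝ (Fin d)))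
    (φ : EuclideanSpace ℝ (Fin d) → ℝ) (ε : ℝ) (y : EuclideanSpace ℝ (Fin d)) : ℝ :=
  ∫ s in normalSlice (2 * ρ) E (shiftTube ρ E φ ε) y, |normalJac (normalGradient E) (y, s)|

variable [Nontrivial (EuclideanSpace ℝ (Fin d))]

/-- Only heights within `C * |ε|` of `ρ` can enter or leave the tube. The constant does not depend
on `y`, as differentiation under the integral requires. -/
lemma IsClassC2.abs_normalContent_sub_le (hE : IsClassC2 E)
    (hC : ∀ x ∈ frontier E, |φ x| ≤ C) {M : ℝ} (hM0 : 0 ≤ M)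
    (hM : ∀ p ∈ frontier E ×ˢ Icc 0 (2 * ρ), |normalJac (normalGradient E) p| ≤ M)
    (hy : y ∈ frontier E) :
    |normalContent ρ E φ ε y - normalContent ρ E φ 0 y| ≤ 2 * M * C * |ε| := by
  have hC0 : 0 ≤ C := (abs_nonneg _).trans (hC y hy)
  have hε : 0 ≤ C * |ε| := by positivity
  have hmem {s : ℝ} (h : |s - ρ| ≤ C * |ε|) : s ∈ Icc (ρ - C * |ε|) (ρ + C * |ε|) := by
    obtain ⟨h1, h2⟩ := abs_le.1 h
    constructor <;> linarith
  have := abs_setIntegral_sub_le (hE.measurableSet_normalSlice (R := 2 * ρ) isOpen_shiftTube y)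
    (hE.measurableSet_normalSlice (R := 2 * ρ) isOpen_shiftTube y)
    (normalSlice_subset (shiftTube ρ E φ ε)) (normalSlice_subset (shiftTube ρ E φ 0))
    (continuous_normalJac (normalGradient E) y).abs hM0
    (fun s hs => by rw [abs_abs]; exact hM (y, s) ⟨hy, hs⟩)
    (a := ρ - C * |ε|) (b := ρ + C * |ε|) (by linarith)
    (fun s hs => hmem (hE.abs_sub_le_of_mem_diff ⟨y, hy⟩ hC hs.1.1 fun hiff =>
      hs.2 ⟨hs.1.1, hiff.1 hs.1.2⟩))
    (fun s hs => hmem (hE.abs_sub_le_of_mem_diff ⟨y, hy⟩ hC hs.1.1 fun hiff =>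
      hs.2 ⟨hs.1.1, hiff.2 hs.1.2⟩))
  refine this.trans_eq ?_
  ring

/-- Beyond the cut point the tube does not change. -/
lemma IsClassC2.hasDerivAt_normalContent_of_lt (hE : IsClassC2 E)
    (hC : ∀ x ∈ frontier E, |φ x| ≤ C) (hy : y ∈ frontier E)
    (h : Metric.infDist (y + ρ • outerNormal E y) E < ρ) :
    HasDerivAt (fun ε => normalContent ρ E φ ε y) 0 0 := by
  have hc : Continuous fun s : ℝ => Metric.infDist (y + s • outerNormal E y) E - s :=
    ((Metric.continuous_infDist_pt E).comp (by fun_prop)).sub continuous_id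
  obtain ⟨δ, hδ, hδ'⟩ := Metric.eventually_nhds_iff.1
    (hc.continuousAt.eventually (gt_mem_nhds (sub_neg.2 h)))
  have hev : ∀ᶠ ε : ℝ in 𝓝 0, C * |ε| < δ := by
    have : Continuous fun ε : ℝ => C * |ε| := by fun_prop
    exact this.continuousAt.eventually (gt_mem_nhds (by simpa))
  refine (hasDerivAt_const (0 : ℝ) (normalContent ρ E φ 0 y)).congr_of_eventuallyEq ?_
  filter_upwards [hev] with ε hε
  have : normalSlice (2 * ρ) E (shiftTube ρ E φ ε) y =
      normalSlice (2 * ρ) E (shiftTube ρ E φ 0) y := by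
    ext s
    refine and_congr_right fun hs => ?_
    by_contra hiff
    have h1 := hE.abs_sub_le_of_mem_diff ⟨y, hy⟩ hC hs hiff
    have h2 := hδ' (y := s) (by rw [Real.dist_eq]; exact h1.trans_lt hε)
    have h3 := hE.infDist_of_mem_normalDomain hs
    rw [normalMap] at h3
    dsimp only at h3
    rw [h3] at h2
    linarith
  rw [normalContent, this, normalContent]

/-- Before the cut point the tube grows with the speed of the boundary. -/
lemma IsClassC2.hasDerivAt_normalContent_of_gt (hE : IsClassC2 E)
    (hφ : ContinuousOn φ (frontier E)) (hC : ∀ x ∈ frontier E, |φ x| ≤ C) (hρ : 0 < ρ) {M : ℝ}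
    (hM0 : 0 ≤ M) (hM : ∀ p ∈ frontier E ×ˢ Icc 0 (2 * ρ), |normalJac (normalGradient E) p| ≤ M)
    (hy : y ∈ frontier E) {T : ℝ} (hT : ρ < T)
    (h : Metric.infDist (y + T • outerNormal E y) E = T) :
    HasDerivAt (fun ε => normalContent ρ E φ ε y)
      (normalJac (normalGradient E) (y, ρ) * φ y) 0 := by
  have hC0 : 0 ≤ C := (abs_nonneg _).trans (hC y hy)
  have hEne : E.Nonempty := by
    rw [nonempty_iff_ne_empty]; rintro rfl; simp at hy
  set j : ℝ → ℝ := fun s => |normalJac (normalGradient E) (y, s)| with hj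
  have hjc : Continuous j := (continuous_normalJac (normalGradient E) y).abs
  have hjρ : j ρ = normalJac (normalGradient E) (y, ρ) :=
    abs_of_pos (hE.normalJac_pos hy hρ.le hT h)
  -- The model in which the tube occupies exactly `(0, ρ + ε φ(y))`. It suffices that the true
  -- content differs from it by `o(ε)`.
  set G : ℝ → ℝ := fun ε => ∫ s in (0)..(ρ + ε * φ y), j s with hG
  have hGd : HasDerivAt G (j ρ * φ y) 0 := by
    have h1 : HasDerivAt (fun ε : ℝ => ρ + ε * φ y) (φ y) 0 := by
      simpa using ((hasDerivAt_id (0 : ℝ)).mul_const (φ y)).const_add ρ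
    have h2 : HasDerivAt (fun u => ∫ s in (0)..u, j s) (j ρ) (ρ + 0 * φ y) := by
      rw [zero_mul, add_zero]
      exact intervalIntegral.integral_hasDerivAt_right (hjc.intervalIntegrable _ _)
        (hjc.stronglyMeasurableAtFilter _ _) hjc.continuousAt
    exact h2.comp 0 h1
  have hdiff (η : ℝ) (hη : 0 < η) : ∀ᶠ ε : ℝ in 𝓝 0,
      |normalContent ρ E φ ε y - G ε| ≤ M * (η * |ε|) := by
    obtain ⟨δ, hδ, hδ'⟩ := hE.exists_infDist_normalShift_ge hφ hC hρ hy hT h hη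
    have hev : ∀ᶠ ε : ℝ in 𝓝 0, |ε| < δ ∧ C * |ε| < δ ∧ C * |ε| < ρ ∧ C * |ε| < T - ρ := by
      have h1 : Continuous fun ε : ℝ => C * |ε| := by fun_prop
      exact (continuous_abs.continuousAt.eventually (gt_mem_nhds (by simpa))).and
        ((h1.continuousAt.eventually (gt_mem_nhds (by simpa))).and
        ((h1.continuousAt.eventually (gt_mem_nhds (by simpa))).and
        (h1.continuousAt.eventually (gt_mem_nhds (by simpa)))))
    filter_upwards [hev] with ε hε
    obtain ⟨hε1, hε2, hε3, hε4⟩ := hε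
    have hεφ : |ε * φ y| ≤ C * |ε| := by
      rw [abs_mul, mul_comm]; gcongr; exact hC y hy
    obtain ⟨hl, hu⟩ := abs_le.1 hεφ
    have hGe : G ε = ∫ s in Ioo 0 (ρ + ε * φ y), j s := by
      rw [hG]
      simp only
      rw [intervalIntegral.integral_of_le (by linarith), integral_Ioc_eq_integral_Ioo]
    have hηε : 0 ≤ η * |ε| := by positivity
    rw [hGe, normalContent]
    -- The whole model interval lies in the tube, as the displaced foot of `y` itself shows. Any
    -- excess has length at most `η * |ε|` by the lower bound on the distance.
    refine (abs_setIntegral_sub_le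
      (hE.measurableSet_normalSlice (R := 2 * ρ) isOpen_shiftTube y)
      measurableSet_Ioo (normalSlice_subset (shiftTube ρ E φ ε))
      (fun s hs => ⟨hs.1.le, by linarith [hs.2]⟩) hjc hM0
      (fun s hs => by rw [hj]; simp only [abs_abs]; exact hM (y, s) ⟨hy, hs⟩)
      (a := ρ + ε * φ y) (b := ρ + ε * φ y + η * |ε|) (by linarith) ?_ ?_).trans_eq (by ring)
    · rintro s ⟨⟨hs1, hs2⟩, hs3⟩
      have hsge : ρ + ε * φ y ≤ s := not_lt.1 fun hlt => hs3 ⟨hs1.2.1.1, hlt⟩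
      have h2 : Metric.infDist (y + s • outerNormal E y) (frontier E) = s :=
        (hE.infDist_frontier hEne (hE.notMem_closure_of_mem_normalDomain hs1)).trans
          (hE.infDist_of_mem_normalDomain hs1)
      have h3 := hE.abs_infDist_normalShift_sub_le (ε := ε) ⟨y, hy⟩ hC (y + s • outerNormal E y)
      rw [h2] at h3
      have h4 : Metric.infDist (y + s • outerNormal E y) (normalShift E φ ε '' frontier E) < ρ :=
        hs2
      have h5 : |s - ρ| < δ := by
        have := (abs_le.1 h3).1
        rw [abs_lt]
        constructor <;> linarith
      have h6 := hδ' ε s hε1 h5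
      exact ⟨hsge, by linarith⟩
    · rintro s ⟨hs1, hs2⟩
      refine absurd ⟨hE.mem_normalDomain hy ⟨hs1.1, ?_⟩ ?_ h, ?_⟩ hs2
      · linarith [hs1.2]
      · linarith [hs1.2]
      · refine (hE.infDist_normalShift_le hy s).trans_lt ?_
        rw [abs_lt]
        constructor <;> linarith [hs1.1, hs1.2]
  have h0 : normalContent ρ E φ 0 y - G 0 = 0 := by
    have := (hdiff 1 one_pos).self_of_nhds
    simpa using this
  have hdd : HasDerivAt (fun ε => normalContent ρ E φ ε y - G ε) 0 0 := by
    rw [hasDerivAt_iff_isLittleO]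
    refine Asymptotics.isLittleO_iff.2 fun c hc => ?_
    filter_upwards [hdiff (c / (M + 1)) (by positivity)] with ε hε
    rw [h0, sub_zero, sub_zero, smul_zero, sub_zero, Real.norm_eq_abs, Real.norm_eq_abs]
    refine hε.trans ?_
    rw [← mul_assoc]
    gcongr
    rw [mul_div_assoc', div_le_iff₀ (by positivity)]
    nlinarith
  have := hdd.add hGd
  rw [hjρ, zero_add] at this
  refine this.congr_of_eventuallyEq (Eventually.of_forall fun ε => ?_)
  simp

end NormalShift

/-! ### First variation of the volume of the tube -/

section FirstVariation

variable {d : ℕ} {E : Set (EuclideanSpace ℝ (Fin d))} {φ : EuclideanSpace ℝ (Fin d) → ℝ} {ρ : ℝ}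

lemma IsClassC2.aestronglyMeasurable_kappaPlus_mul (hE : IsClassC2 E)
    (hφ : ContinuousOn φ (frontier E)) (μ : Measure (EuclideanSpace ℝ (Fin d))) :
    AEStronglyMeasurable (fun x => kappaPlus ρ E x * φ x) (μ.restrict (frontier E)) := by
  have hS : MeasurableSet (frontier E) := isClosed_frontier.measurableSet
  set K := {y | y ∈ frontier E ∧ Metric.infDist (y + ρ • outerNormal E y) E = ρ} with hK
  have hmap : MapsTo (fun y => (y, ρ)) (frontier E) (frontier E ×ˢ univ) :=
    fun y hy => ⟨hy, trivial⟩
  have hc : ContinuousOn (fun y => 1 / (2 * ρ) * normalJac (normalGradient E) (y, ρ) * φ y)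
      (frontier E) :=
    (continuousOn_const.mul (hE.isNormalField.continuousOn_normalJac.comp
      (by fun_prop) hmap)).mul hφ
  refine ((hc.aestronglyMeasurable hS).indicator
    (hE.isClosed_infDist_eq ρ).measurableSet).congr ?_
  filter_upwards [ae_restrict_mem hS] with y hy
  by_cases h : Metric.infDist (y + ρ • outerNormal E y) E = ρ
  · rw [indicator_of_mem (show y ∈ K from ⟨hy, h⟩), kappaPlus, if_pos h]
    rfl
  · rw [indicator_of_notMem fun hy' : y ∈ K => h hy'.2, kappaPlus, if_neg h, zero_mul]

/-- Justifies cutting the normal coordinates off at `2 * ρ`: for small `ε` the displaced tube stays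
within that distance. -/
lemma IsClassC2.infDist_lt_of_mem_shiftTube (hE : IsClassC2 E) (hne : (frontier E).Nonempty)
    {C ε : ℝ} (hC : ∀ x ∈ frontier E, |φ x| ≤ C) (hε : C * |ε| < ρ)
    {z : EuclideanSpace ℝ (Fin d)} (hz : z ∈ shiftTube ρ E φ ε) (hzE : z ∉ closure E) :
    Metric.infDist z E < 2 * ρ := by
  have hEne : E.Nonempty := by
    rw [nonempty_iff_ne_empty]; rintro rfl; simp at hne
  rw [← hE.infDist_frontier hEne hzE]
  have h1 := (abs_le.1 (hE.abs_infDist_normalShift_sub_le (ε := ε) hne hC z)).1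
  have h2 : Metric.infDist z (normalShift E φ ε '' frontier E) < ρ := hz
  linarith

/-- First variation of the volume of the part of the tube outside `E`. -/
theorem IsClassC2.hasDerivAt_volume_outer (hE : IsClassC2 E) (hS : IsCompact (frontier E))
    (hne : (frontier E).Nonempty) (hρ : 0 < ρ) (hN : μHE[d - 1] (NPlus ρ E) = 0)
    (hφ : ContinuousOn φ (frontier E)) :
    (∀ᶠ ε in 𝓝 (0 : ℝ), volume ((closure E)ᶜ ∩ shiftTube ρ E φ ε) ≠ ∞) ∧
    IntegrableOn (fun x => 2 * ρ * (kappaPlus ρ E x * φ x)) (frontier E) μHE[d - 1] ∧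
    HasDerivAt (fun ε => (volume ((closure E)ᶜ ∩ shiftTube ρ E φ ε)).toReal)
      (∫ x in frontier E, 2 * ρ * (kappaPlus ρ E x * φ x) ∂μHE[d - 1]) 0 := by
  have := hE.nontrivial hne
  have hEne : E.Nonempty := by
    rw [nonempty_iff_ne_empty]; rintro rfl; simp at hne
  have hd : finrank ℝ (EuclideanSpace ℝ (Fin d)) = d := by simp
  have hfin : (μHE[d - 1] : Measure (EuclideanSpace ℝ (Fin d))) (frontier E) < ∞ := by
    simpa [hd] using hE.isNormalField.measure_lt_top hS
  have : IsFiniteMeasure ((μHE[d - 1] : Measure (EuclideanSpace ℝ (Fin d))).restrict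
    (frontier E)) := ⟨by rwa [Measure.restrict_apply_univ]⟩
  obtain ⟨C, hC⟩ := hS.exists_bound_of_continuousOn hφ
  obtain ⟨M, hM0, hM⟩ := hE.exists_normalJac_le hS (2 * ρ)
  have hs : {ε : ℝ | C * |ε| < ρ} ∈ 𝓝 (0 : ℝ) := by
    have : Continuous fun ε : ℝ => C * |ε| := by fun_prop
    exact this.continuousAt.eventually (gt_mem_nhds (by simpa))
  have hvol (ε : ℝ) (hε : C * |ε| < ρ) := hE.volume_toReal_eq_integral hS hEne
    (isOpen_shiftTube (ρ := ρ) (E := E) (φ := φ) (ε := ε))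
    fun z hz hzE => hE.infDist_lt_of_mem_shiftTube hne hC hε hz hzE
  -- The hypothesis on the exceptional set enters here: almost every normal falls under one of the
  -- two pointwise derivative computations.
  have hae : ∀ᵐ y ∂((μHE[d - 1] : Measure (EuclideanSpace ℝ (Fin d))).restrict (frontier E)),
      HasDerivAt (fun ε => normalContent ρ E φ ε y) (2 * ρ * (kappaPlus ρ E y * φ y)) 0 := by
    filter_upwards [ae_restrict_mem isClosed_frontier.measurableSet,
      ae_restrict_of_ae (measure_eq_zero_iff_ae_notMem.1 hN)] with y hy hyN
    have hAB : y ∈ APlus ρ E ∪ BPlus ρ E := by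
      by_contra hc
      exact hyN ⟨hy, hc⟩
    rcases hAB with ⟨-, T, hT, h⟩ | ⟨-, h⟩
    · have hd := hE.hasDerivAt_normalContent_of_gt hφ hC hρ hM0 hM hy hT h
      have hi : Metric.infDist (y + ρ • outerNormal E y) E = ρ :=
        infDist_eq_of_le (hE.isNormalField.norm_eq_one y hy) hy (hρ.trans hT) hρ.le
          (le_of_lt hT) h
      convert hd using 1
      rw [kappaPlus, if_pos hi, normalJac]
      field_simp
    · have hd := hE.hasDerivAt_normalContent_of_lt hC hy h
      convert hd using 1
      rw [kappaPlus, if_neg h.ne]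
      ring
  have hint := hE.volume_toReal_eq_integral hS hEne
    (isOpen_shiftTube (ρ := ρ) (E := E) (φ := φ) (ε := 0))
    fun z hz hzE => hE.infDist_lt_of_mem_shiftTube hne hC (by simpa) hz hzE
  have hmeas : AEStronglyMeasurable (fun y =>
      ContinuousLinearMap.toSpanSingleton ℝ (2 * ρ * (kappaPlus ρ E y * φ y)))
      ((μHE[d - 1] : Measure (EuclideanSpace ℝ (Fin d))).restrict (frontier E)) := by
    have hcl : Continuous fun c : ℝ => ContinuousLinearMap.toSpanSingleton ℝ c :=
      (ContinuousLinearMap.toSpanSingletonLE ℝ ℝ ℝ : ℝ ≃ₗ[ℝ] ℝ →L[ℝ] ℝ).toLinearMap.continuous_of_finiteDimensional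
    exact hcl.comp_aestronglyMeasurable ((hE.aestronglyMeasurable_kappaPlus_mul hφ _).const_mul _)
  -- This form needs the Lipschitz bound only against the base point `ε = 0`, which is the
  -- comparison available. The bound is a constant on a surface of finite measure.
  obtain ⟨k1, k2⟩ := hasFDerivAt_integral_of_dominated_loc_of_lip'
    (μ := (μHE[d - 1] : Measure (EuclideanSpace ℝ (Fin d))).restrict (frontier E))
    (F := fun ε y => normalContent ρ E φ ε y) (bound := fun _ => 2 * M * C) hs
    (fun ε hε => (hvol ε hε).2.1.aestronglyMeasurable) hint.2.1 hmeas
    (by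
      filter_upwards [ae_restrict_mem isClosed_frontier.measurableSet] with y hy ε _
      rw [sub_zero, Real.norm_eq_abs, Real.norm_eq_abs]
      exact hE.abs_normalContent_sub_le hC hM0 hM hy) (integrable_const _) hae
  have k3 : Integrable (fun y => 2 * ρ * (kappaPlus ρ E y * φ y))
      ((μHE[d - 1] : Measure (EuclideanSpace ℝ (Fin d))).restrict (frontier E)) := by
    have := k1.apply_continuousLinearMap (1 : ℝ)
    simpa using this
  refine ⟨?_, k3, ?_⟩
  · filter_upwards [hs] with ε hε using (hvol ε hε).1
  · have k4 := k2.hasDerivAt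
    rw [ContinuousLinearMap.integral_apply k1] at k4
    simp only [ContinuousLinearMap.toSpanSingleton_apply, one_smul] at k4
    refine k4.congr_of_eventuallyEq ?_
    filter_upwards [hs] with ε hε using (hvol ε hε).2.2

lemma NPlus_compl (hE : IsClassC2 E) : NPlus ρ Eᶜ = NMinus ρ E := by
  have key (t : ℝ) {x : EuclideanSpace ℝ (Fin d)} (hx : x ∈ frontier E) :
      x + t • outerNormal Eᶜ x = x - t • outerNormal E x := by
    rw [outerNormal_compl hE hx, smul_neg, sub_eq_add_neg]
  have hA : APlus ρ Eᶜ = AMinus ρ E := by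
    ext x
    simp only [APlus, AMinus, frontier_compl, mem_ofPred_eq]
    exact and_congr_right fun hx => by simp only [key _ hx]
  have hB : BPlus ρ Eᶜ = BMinus ρ E := by
    ext x
    simp only [BPlus, BMinus, frontier_compl, mem_ofPred_eq]
    exact and_congr_right fun hx => by simp only [key _ hx]
  rw [NPlus, NMinus, hA, hB, frontier_compl]

/-- The sign cancels against the speed `-φ` used for the complement, so the two halves add up to
`kappa`. -/
lemma kappaPlus_compl (hE : IsClassC2 E) {x : EuclideanSpace ℝ (Fin d)} (hx : x ∈ frontier E) :
    kappaPlus ρ Eᶜ x = -kappaMinus ρ E x := by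
  have h1 : x + ρ • outerNormal Eᶜ x = x - ρ • outerNormal E x := by
    rw [outerNormal_compl hE hx, smul_neg, sub_eq_add_neg]
  rw [kappaPlus, kappaMinus, h1, normalGradient_compl hE hx, smul_neg, ← sub_eq_add_neg]
  split_ifs <;> ring

lemma shiftTube_compl (hE : IsClassC2 E) (ε : ℝ) :
    shiftTube ρ Eᶜ (fun x => -φ x) ε = shiftTube ρ E φ ε := by
  have : normalShift Eᶜ (fun x => -φ x) ε '' frontier Eᶜ = normalShift E φ ε '' frontier E := by
    rw [frontier_compl]
    refine image_congr fun x hx => ?_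
    rw [normalShift, normalShift, outerNormal_compl hE hx]
    simp
  rw [shiftTube, this, shiftTube]

/-- The boundary of a set of class `C²` is negligible. -/
lemma IsClassC2.volume_frontier (hE : IsClassC2 E) (hS : IsCompact (frontier E)) :
    volume (frontier E) = 0 := by
  rcases (frontier E).eq_empty_or_nonempty with h | hne
  · rw [h, measure_empty]
  have := hE.nontrivial hne
  have hfin := hE.isNormalField.measure_lt_top hS
  have : Fact ((μHE[finrank ℝ (EuclideanSpace ℝ (Fin d)) - 1] :
    Measure (EuclideanSpace ℝ (Fin d))) (frontier E) < ∞) := ⟨hfin⟩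
  have h0 : normalMeasure (frontier E) (frontier E ×ˢ {(0 : ℝ)}) = 0 := by
    rw [normalMeasure, Measure.prod_prod]; simp
  have h1 := hE.isNormalField.volume_image_le hS
    (prod_mono (subset_refl (frontier E)) (subset_univ {(0 : ℝ)}))
    (isClosed_frontier.measurableSet.prod (measurableSet_singleton _)) (by rw [h0]; simp)
  rw [Measure.restrict_eq_zero.2 h0, lintegral_zero_measure] at h1
  refine measure_mono_null ?_ (le_antisymm h1 zero_le)
  exact fun x hx => ⟨(x, 0), ⟨hx, rfl⟩, by simp [normalMap]⟩

/-- First variation of the volume of the tube. -/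
theorem IsClassC2.hasDerivAt_volume_shiftTube (hE : IsClassC2 E) (hS : IsCompact (frontier E))
    (hne : (frontier E).Nonempty) (hρ : 0 < ρ) (hN : μHE[d - 1] (exceptionalSet ρ E) = 0)
    (hφ : ContinuousOn φ (frontier E)) :
    (∀ᶠ ε in 𝓝 (0 : ℝ), volume (shiftTube ρ E φ ε) ≠ ∞) ∧
    IntegrableOn (fun x => 2 * ρ * (kappa ρ E x * φ x)) (frontier E) μHE[d - 1] ∧
    HasDerivAt (fun ε => (volume (shiftTube ρ E φ ε)).toReal)
      (∫ x in frontier E, 2 * ρ * (kappa ρ E x * φ x) ∂μHE[d - 1]) 0 := by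
  have hmS : MeasurableSet (frontier E) := isClosed_frontier.measurableSet
  obtain ⟨f1, i1, d1⟩ := hE.hasDerivAt_volume_outer hS hne hρ
    (measure_mono_null subset_union_left hN) hφ
  obtain ⟨f2, i2, d2⟩ := hE.compl.hasDerivAt_volume_outer (φ := fun x => -φ x)
    (by rwa [frontier_compl]) (by rwa [frontier_compl]) hρ
    (by rw [NPlus_compl hE]; exact measure_mono_null subset_union_right hN)
    (by rw [frontier_compl]; exact hφ.neg)
  simp only [shiftTube_compl hE, frontier_compl] at f2 i2 d2
  have hk : EqOn (fun x => 2 * ρ * (kappaPlus ρ E x * φ x) +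
      2 * ρ * (kappaPlus ρ Eᶜ x * -φ x)) (fun x => 2 * ρ * (kappa ρ E x * φ x)) (frontier E) := by
    intro x hx
    simp only [kappaPlus_compl hE hx, kappa]
    ring
  -- The moving tube is cut along the fixed boundary; the two pieces miss only points of `frontier
  -- E`, a null set.
  have hsplit (ε : ℝ) : volume (shiftTube ρ E φ ε) =
      volume ((closure E)ᶜ ∩ shiftTube ρ E φ ε) +
        volume ((closure Eᶜ)ᶜ ∩ shiftTube ρ E φ ε) := by
    rw [← measure_union]
    · refine (measure_eq_measure_of_null_sdiff ?_ ?_).symm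
      · exact union_subset inter_subset_right inter_subset_right
      · refine measure_mono_null ?_ (hE.volume_frontier hS)
        rintro z ⟨hz, hz'⟩
        rw [mem_union, not_or] at hz'
        rw [frontier_eq_closure_inter_closure]
        exact ⟨not_not.1 fun h => hz'.1 ⟨h, hz⟩, not_not.1 fun h => hz'.2 ⟨h, hz⟩⟩
    · refine disjoint_left.2 fun z hz hz' => ?_
      by_cases hzE : z ∈ E
      · exact hz.1 (subset_closure hzE)
      · exact hz'.1 (subset_closure hzE)
    · exact isClosed_closure.isOpen_compl.measurableSet.inter isOpen_shiftTube.measurableSet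
  refine ⟨?_, (i1.add i2).congr_fun hk hmS, ?_⟩
  · filter_upwards [f1, f2] with ε h1 h2
    rw [hsplit]
    exact ENNReal.add_ne_top.2 ⟨h1, h2⟩
  · rw [← setIntegral_congr_fun hmS hk, integral_add i1 i2]
    refine (d1.add d2).congr_of_eventuallyEq ?_
    filter_upwards [f1, f2] with ε h1 h2
    rw [hsplit, ENNReal.toReal_add h1 h2]
    rfl

end FirstVariation

/-! ### The energy as the volume of a tube -/

section Energy

variable {d : ℕ} {E F : Set (EuclideanSpace ℝ (Fin d))} {ρ : ℝ} {x : EuclideanSpace ℝ (Fin d)}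

/-- The essential upper bounds are exactly the half-line from `c`. Identifying this set avoids
separate boundedness conditions for the real-valued infimum. -/
lemma essSup_eq_of_le_of_pos {α : Type*} [MeasurableSpace α] {μ : Measure α} {f : α → ℝ} {c : ℝ}
    (h1 : μ {x | c < f x} = 0) (h2 : μ {x | f x = c} ≠ 0) : essSup f μ = c := by
  have : {a | μ {x | a < f x} = 0} = Ici c := by
    ext a
    simp only [mem_ofPred_eq, mem_Ici]
    constructor
    · intro ha
      by_contra hac
      push Not at hac
      exact h2 (measure_mono_null (fun x (hx : f x = c) => hac.trans_eq hx.symm) ha)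
    · intro ha
      exact measure_mono_null (fun x (hx : a < f x) => ha.trans_lt hx) h1
  rw [essSup_eq_sInf, this, csInf_Ici]

lemma essInf_eq_of_ge_of_pos {α : Type*} [MeasurableSpace α] {μ : Measure α} {f : α → ℝ} {c : ℝ}
    (h1 : μ {x | f x < c} = 0) (h2 : μ {x | f x = c} ≠ 0) : essInf f μ = c := by
  have : {a | μ {x | f x < a} = 0} = Iic c := by
    ext a
    simp only [mem_ofPred_eq, mem_Iic]
    constructor
    · intro ha
      by_contra hac
      push Not at hac
      exact h2 (measure_mono_null (fun x (hx : f x = c) => hx.trans_lt hac) ha)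
    · intro ha
      exact measure_mono_null (fun x (hx : f x < a) => hx.trans_le ha) h1
  rw [essInf_eq_sSup, this, csSup_Iic]

lemma essOsc_eq_zero_of_const {A : Set (EuclideanSpace ℝ (Fin d))} (hA : MeasurableSet A)
    (hA0 : volume A ≠ 0) {u : EuclideanSpace ℝ (Fin d) → ℝ} {c : ℝ} (hu : ∀ x ∈ A, u x = c) :
    essOsc A u = 0 := by
  have h0 : ∀ s : Set (EuclideanSpace ℝ (Fin d)), (∀ x ∈ A, x ∉ s) → volume.restrict A s = 0 := by
    intro s hs
    have : s ∩ A = ∅ := eq_empty_of_forall_notMem fun x hx => hs x hx.2 hx.1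
    rw [Measure.restrict_apply' hA, this, measure_empty]
  have hc : volume.restrict A {x | u x = c} ≠ 0 := by
    rw [Measure.restrict_apply' hA, inter_eq_right.2 (show A ⊆ {x | u x = c} from hu)]; exact hA0
  rw [essOsc, essSup_eq_of_le_of_pos (h0 _ fun x hx (h : c < u x) => h.ne' (hu x hx)) hc,
    essInf_eq_of_ge_of_pos (h0 _ fun x hx (h : u x < c) => h.ne (hu x hx)) hc, sub_self]

/-- The oscillation vanishes on balls that do not meet the boundary. -/
lemma essOsc_ball_eq_zero (hρ : 0 < ρ) (h : Disjoint (Metric.ball x ρ) (frontier F)) :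
    essOsc (Metric.ball x ρ) (F.indicator fun _ => (1 : ℝ)) = 0 := by
  have hb0 : volume (Metric.ball x ρ) ≠ 0 := (Metric.measure_ball_pos volume x hρ).ne'
  by_cases h1 : (Metric.ball x ρ ∩ F).Nonempty
  · by_cases h2 : (Metric.ball x ρ ∩ Fᶜ).Nonempty
    · obtain ⟨y, hy⟩ := inter_frontier_nonempty (convex_ball x ρ).isPreconnected h1 h2
      exact absurd hy.2 (disjoint_left.1 h hy.1)
    · refine essOsc_eq_zero_of_const measurableSet_ball hb0 (c := 1) fun y hy => ?_
      refine indicator_of_mem (by_contra fun hyF => h2 ⟨y, hy, hyF⟩) _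
  · refine essOsc_eq_zero_of_const measurableSet_ball hb0 (c := 0) fun y hy => ?_
    exact indicator_of_notMem (fun hyF => h1 ⟨y, hy, hyF⟩) _

/-- The oscillation is `1` on balls that meet a boundary with interior points on both sides. -/
lemma essOsc_ball_eq_one (h1 : frontier F ⊆ closure (interior F))
    (h2 : frontier F ⊆ closure (interior Fᶜ)) (h : ¬ Disjoint (Metric.ball x ρ) (frontier F)) :
    essOsc (Metric.ball x ρ) (F.indicator fun _ => (1 : ℝ)) = 1 := by
  obtain ⟨y, hyb, hyF⟩ := not_disjoint_iff.1 h
  have key {G : Set (EuclideanSpace ℝ (Fin d))} (hG : y ∈ closure (interior G)) :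
      volume.restrict (Metric.ball x ρ) G ≠ 0 := by
    have hpos : 0 < volume (interior G ∩ Metric.ball x ρ) :=
      (isOpen_interior.inter Metric.isOpen_ball).measure_pos volume
        (by rw [inter_comm]; exact mem_closure_iff.1 hG _ Metric.isOpen_ball hyb)
    rw [Measure.restrict_apply' measurableSet_ball]
    exact (hpos.trans_le (measure_mono (inter_subset_inter_left _ interior_subset))).ne'
  have hle (x : EuclideanSpace ℝ (Fin d)) : F.indicator (fun _ => (1 : ℝ)) x ≤ 1 :=
    indicator_le_self' (fun _ _ => zero_le_one) x
  have hge (x : EuclideanSpace ℝ (Fin d)) : 0 ≤ F.indicator (fun _ => (1 : ℝ)) x :=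
    indicator_nonneg (fun _ _ => zero_le_one) x
  rw [essOsc, essSup_eq_of_le_of_pos (c := 1), essInf_eq_of_ge_of_pos (c := 0), sub_zero]
  · simp [(hge _).not_gt]
  · have : {x | F.indicator (fun _ => (1 : ℝ)) x = 0} = Fᶜ := by ext x; simp
    rw [this]
    exact key (h2 hyF)
  · simp [(hle _).not_gt]
  · have : {x | F.indicator (fun _ => (1 : ℝ)) x = 1} = F := by ext x; simp [indicator]
    rw [this]
    exact key (h1 hyF)

/-- The energy is the normalised volume of the `ρ`-neighbourhood of the boundary. -/
lemma energy_eq_volume (hρ : 0 < ρ) (hne : (frontier F).Nonempty)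
    (h1 : frontier F ⊆ closure (interior F)) (h2 : frontier F ⊆ closure (interior Fᶜ)) :
    energy ρ F = ENNReal.ofReal (1 / (2 * ρ)) *
      volume {z | Metric.infDist z (frontier F) < ρ} := by
  have hm : MeasurableSet {z | Metric.infDist z (frontier F) < ρ} :=
    (isOpen_lt (Metric.continuous_infDist_pt _) continuous_const).measurableSet
  rw [energy, ← lintegral_indicator_one hm]
  congr 2
  ext x
  have hiff : Metric.infDist x (frontier F) < ρ ↔ ¬ Disjoint (Metric.ball x ρ) (frontier F) := by
    rw [Metric.infDist_lt_iff hne, not_disjoint_iff]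
    simp only [Metric.mem_ball, dist_comm x]
    exact ⟨fun ⟨y, hy, h⟩ => ⟨y, h, hy⟩, fun ⟨y, h, hy⟩ => ⟨y, hy, h⟩⟩
  by_cases hx : Metric.infDist x (frontier F) < ρ
  · rw [indicator_of_mem (by exact hx), essOsc_ball_eq_one h1 h2 (hiff.1 hx)]
    simp
  · rw [indicator_of_notMem (by exact hx),
      essOsc_ball_eq_zero hρ (not_not.1 fun h => hx (hiff.2 h))]
    simp

lemma energy_eq_zero (hρ : 0 < ρ) (h : frontier F = ∅) : energy ρ F = 0 := by
  rw [energy]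
  simp [essOsc_ball_eq_zero hρ (F := F) (by rw [h]; exact disjoint_empty _)]

/-- Moving from a boundary point against the gradient enters the open set where the defining
function is negative. With the same fact for `Eᶜ`, this gives both sides positive measure in each
ball meeting the boundary. -/
lemma IsClassC2.frontier_subset_closure_interior (hE : IsClassC2 E) :
    frontier E ⊆ closure (interior E) := by
  intro x hx
  obtain ⟨U, ψ, h⟩ := hE x hx
  have hd : DifferentiableAt ℝ (fun y => -ψ y) x := h.differentiableAt.fun_neg
  have hpos : 0 < inner ℝ (gradient (fun y => -ψ y) x) (-gradient ψ x) := by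
    have : gradient (fun y => -ψ y) x = -gradient ψ x := by simp [gradient, fderiv_fun_neg]
    rw [this, real_inner_self_eq_norm_sq, norm_neg]
    exact pow_pos h.norm_gradient_pos 2
  have h1 := eventually_pos_of_inner_gradient_pos hd (by simp [h.eq_zero hx]) hpos
  have hc : Tendsto (fun r : ℝ => x + r • -gradient ψ x) (𝓝[>] 0) (𝓝 x) := by
    have : Continuous fun r : ℝ => x + r • -gradient ψ x := by fun_prop
    simpa using (this.tendsto 0).mono_left nhdsWithin_le_nhds
  refine mem_closure_of_tendsto hc ?_
  filter_upwards [h1, hc.eventually (h.isOpen.mem_nhds h.mem)] with r hr hrU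
  have ho : IsOpen (U ∩ ψ ⁻¹' Iio 0) :=
    h.contDiffOn.continuousOn.isOpen_inter_preimage h.isOpen isOpen_Iio
  refine mem_interior.2 ⟨U ∩ ψ ⁻¹' Iio 0, fun y hy => h.neg y hy.1 hy.2, ho, hrU, ?_⟩
  rw [mem_preimage, mem_Iio]
  linarith

/-- The energy of a homeomorphic image of a set of class `C²`. -/
lemma IsClassC2.energy_image (hE : IsClassC2 E) (hne : (frontier E).Nonempty) (hρ : 0 < ρ)
    (f : EuclideanSpace ℝ (Fin d) ≃ₜ EuclideanSpace ℝ (Fin d)) :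
    energy ρ (f '' E) = ENNReal.ofReal (1 / (2 * ρ)) *
      volume {z | Metric.infDist z (f '' frontier E) < ρ} := by
  rw [f.image_frontier]
  refine energy_eq_volume hρ ?_ ?_ ?_
  · rw [← f.image_frontier]; exact hne.image f
  · rw [← f.image_frontier, ← f.image_interior, ← f.image_closure]
    exact image_mono hE.frontier_subset_closure_interior
  · rw [← f.image_frontier, ← image_compl_eq f.bijective, ← f.image_interior, ← f.image_closure,
      ← frontier_compl]
    exact image_mono hE.compl.frontier_subset_closure_interior

end Energy

end NonlocalCurvature

end

/-! ### The first variation of the energy -/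

theorem mainTheorem6 {d : ℕ} {ρ : ℝ} (hρ : 0 < ρ)
    (E : Set (EuclideanSpace ℝ (Fin d)))
    (hE : NonlocalCurvature.IsClassC2 E)
    (hcompact : IsCompact (frontier E))
    (hN : μHE[d - 1] (NonlocalCurvature.exceptionalSet ρ E) = 0)
    (φ : EuclideanSpace ℝ (Fin d) → ℝ)
    (hφ : ContDiffOn ℝ 2 φ (frontier E))
    (Φ : ℝ → Diffeomorph 𝓘(ℝ, EuclideanSpace ℝ (Fin d)) 𝓘(ℝ, EuclideanSpace ℝ (Fin d))
      (EuclideanSpace ℝ (Fin d)) (EuclideanSpace ℝ (Fin d)) 1)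
    (hΦ : ∀ᶠ ε in 𝓝 (0 : ℝ), ∀ x ∈ frontier E,
      Φ ε x = x + (ε * φ x) • NonlocalCurvature.outerNormal E x) :
    (∀ᶠ ε in 𝓝 (0 : ℝ), NonlocalCurvature.energy ρ (Φ ε '' E) ≠ ⊤) ∧
    IntegrableOn (fun x => NonlocalCurvature.kappa ρ E x * φ x) (frontier E) μHE[d - 1] ∧
    HasDerivAt (fun ε => (NonlocalCurvature.energy ρ (Φ ε '' E)).toReal)
      (∫ x in frontier E, NonlocalCurvature.kappa ρ E x * φ x ∂μHE[d - 1]) 0 := by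
  -- The empty boundary is separate because `Metric.infDist` to the empty set is `0`, so `shiftTube`
  -- would be the whole space although the energy vanishes.
  rcases (frontier E).eq_empty_or_nonempty with hem | hne
  · have h0 (ε : ℝ) : NonlocalCurvature.energy ρ (Φ ε '' E) = 0 := by
      refine NonlocalCurvature.energy_eq_zero hρ ?_
      have := (Φ ε).toHomeomorph.image_frontier E
      rw [hem, image_empty] at this
      exact this.symm
    simp only [h0, hem]
    simp [hasDerivAt_const]
  obtain ⟨h1, h2, h3⟩ := hE.hasDerivAt_volume_shiftTube hcompact hne hρ hN hφ.continuousOn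
  have hen : ∀ᶠ ε in 𝓝 (0 : ℝ), NonlocalCurvature.energy ρ (Φ ε '' E) =
      ENNReal.ofReal (1 / (2 * ρ)) * volume (NonlocalCurvature.shiftTube ρ E φ ε) := by
    filter_upwards [hΦ] with ε hε
    have h4 := hE.energy_image hne hρ (Φ ε).toHomeomorph
    have h5 : (Φ ε).toHomeomorph '' frontier E =
        NonlocalCurvature.normalShift E φ ε '' frontier E := image_congr hε
    rw [h5] at h4
    exact h4
  have hinv : 1 / (2 * ρ) * (2 * ρ) = 1 := by field_simp
  have hcongr (x : EuclideanSpace ℝ (Fin d)) : 1 / (2 * ρ) *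
      (2 * ρ * (NonlocalCurvature.kappa ρ E x * φ x)) = NonlocalCurvature.kappa ρ E x * φ x := by
    rw [← mul_assoc, hinv, one_mul]
  refine ⟨?_, ?_, ?_⟩
  · filter_upwards [hen, h1] with ε hε hε1
    rw [hε]
    exact ENNReal.mul_ne_top ENNReal.ofReal_ne_top hε1
  · have := h2.const_mul (1 / (2 * ρ))
    simp only [hcongr] at this
    exact this
  · have := h3.const_mul (1 / (2 * ρ))
    rw [← integral_const_mul] at this
    simp only [hcongr] at this
    refine this.congr_of_eventuallyEq ?_
    filter_upwards [hen] with ε hε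
    rw [hε, ENNReal.toReal_mul, ENNReal.toReal_ofReal (by positivity)]
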